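/- Let $n\ge 1$ and, for $0<s\le 1$ and $t>0$, let $$P_t(x)=P(x,t;s)=(2\pi)^{-n}\int_{\mathbb R^n}e^{ix\cdot\xi}\,e^{-t|\xi|^{2s}}\,d\xi$$ be the fundamental solution of $\partial_t u+(-\Delta)^s u=0$ in $\mathbb R^n$. For $u_0\in L^1(\mathbb R^n)$ put $M=\int_{\mathbb R^n}u_0\,dx$, and let $u(x,t)=\int_{\mathbb R^n} P_t(x-y)\,u_0(y)\,dy$ be the solution with initial datum $u_0$. (a) Let $0<s<1$. There is a constant $C=C(n,s)>0$ such that for every $R>0$ there is a time $T=T(n,s,R)>0$ with the following property: for every $u_0\in L^1(\mathbb R^n)$, of any sign, that vanishes almost everywhere outside the ball $B_R(0)$ of radius $R$ centred at the origin, and for every $t\ge T$, one has $P_t>0$ everywhere and $$\frac{|u(x,t)-M P_t(x)|}{P_t(x)}\le C\,\|u_0\|_{L^1(\mathbb R^n)}\,R\,t^{-1/2s}\qquad\text{for all }x\in\mathbb R^n .$$ In particular, if $u_0\ge 0$, the bound is $C\,M\,R\,t^{-1/2s}$. The same bound (with $\|u_0\|_{L^1}$) holds, for almost every $x$, for every weak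 solution $u\in C([0,\infty);L^1(\mathbb R^n))$ with $u(\cdot,0)=u_0$, that is, with $$\int u(x,t)\varphi(x)\,dx=\int u_0(x)\varphi(x)\,dx-\int_0^t\!\!\int u(x,\tau)\,(-\Delta)^s\varphi(x)\,dx\,d\tau$$ for all $t\ge0$ and all $\varphi\in C_c^\infty(\mathbb R^n)$, where $(-\Delta)^s$ has Fourier symbol $|\xi|^{2s}$. (b) Let $s=1$ (the Gaussian case). Then there is no such bound: for every $h\ne 0$ and every $t>0$ the relative error of the translate $u(x,t)=P_t(x-h)$ (with $M=1$) is unbounded in $x$; and likewise, for every $u_0\in L^1(\mathbb R^n)$ with $u_0\ge 0$, $M>0$ and support in some ball $B_R(0)$, the function $|u(x,t)-MP_t(x)|/P_t(x)$ is unbounded in $x$ for every $t>0$. -/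

import Mathlib

open MeasureTheory Filter Topology
open scoped FourierTransform

noncomputable section

/-- The fundamental solution `P(x,t;s)` of `∂ₜu + (-Δ)^s u = 0` on `ℝⁿ`: the inverse Fourier
transform of `exp (-t |ξ|^{2s})`.  Mathlib's transform uses the character `exp (2πi⟪x,ξ⟫)`, so the
frequency `ξ` of the usual (angular) convention is `2πξ` here; for `s = 1` this gives the Gaussian
`(4πt)^{-n/2} exp (-|x|²/4t)`.  The symbol is real and even, so the transform is real. -/
def heatKernel {n : ℕ} (s t : ℝ) (x : EuclideanSpace ℝ (Fin n)) : ℝ :=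
  (𝓕⁻ (fun ξ : EuclideanSpace ℝ (Fin n) =>
    ((Real.exp (-(t * (2 * Real.pi * ‖ξ‖) ^ (2 * s))) : ℝ) : ℂ)) x).re

/-- The solution given by the representation formula `u(x,t) = ∫ P(x-y,t;s) u₀(y) dy`. -/
def heatSolution {n : ℕ} (s : ℝ) (u₀ : EuclideanSpace ℝ (Fin n) → ℝ) (t : ℝ)
    (x : EuclideanSpace ℝ (Fin n)) : ℝ :=
  ∫ y, heatKernel s t (x - y) * u₀ y

/-- The fractional Laplacian `(-Δ)^s φ` of a test function, through its Fourier symbol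
`|ξ|^{2s}`.  For real `φ` the result is real. -/
def fracLaplacian {n : ℕ} (s : ℝ) (φ : EuclideanSpace ℝ (Fin n) → ℝ)
    (x : EuclideanSpace ℝ (Fin n)) : ℝ :=
  (𝓕⁻ (fun ξ : EuclideanSpace ℝ (Fin n) =>
    (((2 * Real.pi * ‖ξ‖) ^ (2 * s) : ℝ) : ℂ) *
      𝓕 (fun y : EuclideanSpace ℝ (Fin n) => ((φ y : ℝ) : ℂ)) ξ) x).re

/-- `u` is a weak solution of `∂ₜu + (-Δ)^s u = 0` in `ℝⁿ × (0,∞)`, in the class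
`C([0,∞); L¹(ℝⁿ))`, with initial datum `u₀`: the equation holds when tested with every smooth,
compactly supported `φ`. -/
structure IsWeakSolution {n : ℕ} (s : ℝ) (u₀ : EuclideanSpace ℝ (Fin n) → ℝ)
    (u : ℝ → EuclideanSpace ℝ (Fin n) → ℝ) : Prop where
  integrable : ∀ t : ℝ, 0 ≤ t → Integrable (u t)
  continuous_L1 : ∀ t : ℝ, 0 ≤ t →
    Tendsto (fun τ : ℝ => ∫ x, |u τ x - u t x|) (𝓝[Set.Ici 0] t) (𝓝 0)
  initial : u 0 =ᵐ[volume] u₀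
  weak : ∀ φ : EuclideanSpace ℝ (Fin n) → ℝ, ContDiff ℝ (⊤ : ℕ∞) φ → HasCompactSupport φ →
    ∀ t : ℝ, 0 ≤ t →
      ∫ x, u t x * φ x =
        (∫ x, u₀ x * φ x) - ∫ τ in (0 : ℝ)..t, ∫ x, u τ x * fracLaplacian s φ x

/-- The relative error `|v(x) - M P_t(x)| / P_t(x)` of a profile `v` at time `t`. -/
def relError {n : ℕ} (s M t : ℝ) (v : EuclideanSpace ℝ (Fin n) → ℝ)
    (x : EuclideanSpace ℝ (Fin n)) : ℝ :=
  |v x - M * heatKernel s t x| / heatKernel s t x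

end

/-! ### The one-sided stable law -/

/-! Fractional case. Since u(x,t) - M P_t(x) = ∫ (P_t(x-y) - P_t(x)) u₀(y) dy, everything follows
from one estimate: log P_t is Lipschitz at the scale σ = t^{1/2s}, that is, |P_t(x-y) - P_t(x)| ≤ C
(|y|/σ) P_t(x) whenever |y| ≤ σ, with C independent of x and t (`heatKernel_pos_and_abs_sub_le`).
The time T only ensures R ≤ σ.

For this estimate P_t is written as a mixture of Gaussians (subordination, `fourierInv_heatSymbol`):
if μ is a law on (0,∞) with Laplace transform exp(-λ^s), then up to a factor depending on t alone
P_t(x) is g(|x|/σ), with g(r) = ∫ τ^{-n/2} exp(-r²/4τ) dμ(τ). The law μ is built as a limit of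
normalised sums of independent Pareto variables (`exists_stable_law`). In g(r') - g(r), the part τ ≥
1+r changes by a relative amount O(|r-r'|), since the exponents there are Lipschitz in r; the part τ
< 1+r is exponentially small in r. The latter is absorbed by a polynomial lower bound for g, which
expresses the heavy tail of μ and is where s < 1 is essential (`IsStableLaw.exists_lower_bound`).
That bound is read off the Laplace transform alone, by integrating a combination of exponentials
that is negative near 0 but has positive mean at large scales.

Weak solutions reduce to the representation formula: testing with cut-off plane waves and removing
the cutoff shows that each Fourier coefficient solves y' = -|2πξ|^{2s} y, and Fourier inversion in
L¹ identifies u(t) almost everywhere (`IsWeakSolution.ae_eq_heatSolution`).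

Gaussian case. The ratio P_t(x-y)/P_t(x) = exp((2x·y - |y|²)/4t) is explicit and unbounded as x goes
to infinity in a direction with x·y > 0; averaging it against u₀ ≥ 0 keeps at least linear growth in
a suitable direction. -/

lemma integrableOn_one_sub_exp_neg_mul_rpow {s : ℝ} (hs0 : 0 < s) (hs1 : s < 1) :
    IntegrableOn (fun u : ℝ => (1 - Real.exp (-u)) * u ^ (-(s + 1))) (Set.Ioi 0) := by
  have hmeas : Measurable (fun u : ℝ => (1 - Real.exp (-u)) * u ^ (-(s + 1))) := by fun_prop
  -- Near 0 the inequality 1 - e^{-u} ≤ u leaves u^{-s}, integrable because s < 1; beyond 1 the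
  -- integrand is at most u^{-s-1}, integrable because s > 0.
  rw [← Set.Ioc_union_Ioi_eq_Ioi (zero_le_one' ℝ)]
  refine IntegrableOn.union ?_ ?_
  · have h : IntegrableOn (fun u : ℝ => u ^ (-s)) (Set.Ioc 0 1) := by
      rw [← intervalIntegrable_iff_integrableOn_Ioc_of_le zero_le_one]
      exact intervalIntegral.intervalIntegrable_rpow' (by linarith)
    refine Integrable.mono' h hmeas.aestronglyMeasurable ?_
    refine (ae_restrict_mem measurableSet_Ioc).mono fun u hu => ?_
    have h0 : 0 ≤ 1 - Real.exp (-u) := by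
      have := Real.exp_le_one_iff.2 (neg_nonpos.2 hu.1.le); linarith
    have h1 : 1 - Real.exp (-u) ≤ u := by
      have := Real.add_one_le_exp (-u); linarith
    rw [Real.norm_of_nonneg (mul_nonneg h0 (Real.rpow_nonneg hu.1.le _))]
    calc (1 - Real.exp (-u)) * u ^ (-(s + 1)) ≤ u * u ^ (-(s + 1)) := by
          gcongr; exact Real.rpow_nonneg hu.1.le _
      _ = u ^ (1 + -(s + 1)) := by rw [Real.rpow_add hu.1, Real.rpow_one]
      _ = u ^ (-s) := by ring_nf
  · refine Integrable.mono' (integrableOn_Ioi_rpow_of_lt (a := -(s + 1)) (by linarith) one_pos)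
      hmeas.aestronglyMeasurable ?_
    refine (ae_restrict_mem measurableSet_Ioi).mono fun u hu => ?_
    have hu0 : (0 : ℝ) < u := lt_trans one_pos hu
    have h0 : 0 ≤ 1 - Real.exp (-u) := by
      have := Real.exp_le_one_iff.2 (neg_nonpos.2 hu0.le); linarith
    have hp := Real.rpow_nonneg hu0.le (-(s + 1))
    rw [Real.norm_of_nonneg (mul_nonneg h0 hp)]
    have := (Real.exp_pos (-u)).le
    nlinarith

lemma integral_paretoMeasure_one {s : ℝ} (hs0 : 0 < s) (f : ℝ → ℝ) :
    ∫ x, f x ∂(ProbabilityTheory.paretoMeasure 1 s)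
      = ∫ x in Set.Ioi 1, s * x ^ (-(s + 1)) * f x := by
  have hm : Measurable (ProbabilityTheory.paretoPDF 1 s) :=
    (ProbabilityTheory.measurable_paretoPDFReal 1 s).ennreal_ofReal
  rw [ProbabilityTheory.paretoMeasure, integral_withDensity_eq_integral_toReal_smul
    hm (ae_of_all _ fun x => by simp [ProbabilityTheory.paretoPDF]),
    ← integral_Ici_eq_integral_Ioi, ← integral_indicator measurableSet_Ici]
  congr 1 with x
  by_cases hx : 1 ≤ x
  · have : 0 ≤ x := zero_le_one.trans hx
    rw [Set.indicator_of_mem (by exact hx), ProbabilityTheory.paretoPDF_of_le hx,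
      ENNReal.toReal_ofReal (by positivity)]
    simp
  · rw [Set.indicator_of_notMem (by simpa using hx),
      ProbabilityTheory.paretoPDF_of_lt (not_le.1 hx)]
    simp

lemma ae_paretoMeasure_one_le (s : ℝ) :
    ∀ᵐ x ∂(ProbabilityTheory.paretoMeasure 1 s), 1 ≤ x := by
  rw [ae_iff]
  have : {a : ℝ | ¬ 1 ≤ a} = Set.Iio 1 := by ext; simp
  rw [this, ProbabilityTheory.paretoMeasure, withDensity_apply _ measurableSet_Iio]
  exact ProbabilityTheory.lintegral_paretoPDF_of_le le_rfl

/-- The substitution u = bx in E[1 - e^{-bX}] for X Pareto. The form isolates the factor b^s, whose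
coefficient converges to a positive constant as b → 0: this is the domain of attraction of the
s-stable law. -/
lemma integral_exp_paretoMeasure_one {s b : ℝ} (hs0 : 0 < s) (hb : 0 < b) :
    ∫ x, Real.exp (-(b * x)) ∂(ProbabilityTheory.paretoMeasure 1 s)
      = 1 - b ^ s * (s * ∫ u in Set.Ioi b, (1 - Real.exp (-u)) * u ^ (-(s + 1))) := by
  have := ProbabilityTheory.isProbabilityMeasure_paretoMeasure one_pos hs0
  have hint : Integrable (fun x => Real.exp (-(b * x)))
      (ProbabilityTheory.paretoMeasure 1 s) := by
    refine Integrable.of_bound (C := 1) (by fun_prop) ?_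
    filter_upwards [ae_paretoMeasure_one_le s] with x hx
    rw [Real.norm_of_nonneg (Real.exp_pos _).le, Real.exp_le_one_iff]
    have := mul_pos hb (zero_lt_one.trans_le hx)
    linarith
  have h1 : ∫ x, (1 - Real.exp (-(b * x))) ∂(ProbabilityTheory.paretoMeasure 1 s)
      = 1 - ∫ x, Real.exp (-(b * x)) ∂(ProbabilityTheory.paretoMeasure 1 s) := by
    rw [integral_sub (integrable_const _) hint]; simp
  have h2 : ∫ x, (1 - Real.exp (-(b * x))) ∂(ProbabilityTheory.paretoMeasure 1 s)
      = b ^ s * (s * ∫ u in Set.Ioi b, (1 - Real.exp (-u)) * u ^ (-(s + 1))) := by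
    rw [integral_paretoMeasure_one hs0]
    have h3 := integral_comp_mul_left_Ioi
      (fun u : ℝ => (1 - Real.exp (-u)) * u ^ (-(s + 1))) 1 hb
    rw [mul_one, smul_eq_mul] at h3
    have h4 : ∫ u in Set.Ioi b, (1 - Real.exp (-u)) * u ^ (-(s + 1))
        = b * ∫ x in Set.Ioi 1, (1 - Real.exp (-(b * x))) * (b * x) ^ (-(s + 1)) := by
      rw [h3]; field_simp
    rw [h4, ← integral_const_mul, ← integral_const_mul, ← integral_const_mul]
    refine setIntegral_congr_fun measurableSet_Ioi fun x hx => ?_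
    have hx0 : (0 : ℝ) < x := lt_trans one_pos hx
    have hb1 : b ^ s * b * b ^ (-(s + 1)) = 1 := by
      rw [← Real.rpow_add_one hb.ne', ← Real.rpow_add hb]; simp
    rw [Real.mul_rpow hb.le hx0.le]
    linear_combination (-s * x ^ (-(s + 1)) * (1 - Real.exp (-(b * x)))) * hb1
  linarith

/-- The stable limit theorem at the level of Laplace transforms: each factor is 1 - l^s/N + o(1/N),
so its N-th power tends to exp(-l^s). -/
lemma tendsto_integral_exp_paretoMeasure_pow {s : ℝ} (hs0 : 0 < s) (hs1 : s < 1) :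
    ∃ b : ℕ → ℝ, (∀ N, 0 ≤ b N) ∧ ∀ l : ℝ, 0 < l → Tendsto (fun N : ℕ =>
      (∫ x, Real.exp (-(l * b N * x)) ∂(ProbabilityTheory.paretoMeasure 1 s)) ^ N) atTop
      (𝓝 (Real.exp (-(l ^ s)))) := by
  set g : ℝ → ℝ := fun u => (1 - Real.exp (-u)) * u ^ (-(s + 1)) with hg
  have hgi : IntegrableOn g (Set.Ioi 0) := integrableOn_one_sub_exp_neg_mul_rpow hs0 hs1
  set K : ℝ := s * ∫ u in Set.Ioi 0, g u with hK
  have hgpos : ∀ u ∈ Set.Ioi (0 : ℝ), 0 < g u := fun u hu => by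
    have : Real.exp (-u) < 1 := Real.exp_zero ▸ Real.exp_lt_exp.2 (neg_neg_of_pos hu)
    exact mul_pos (by linarith) (Real.rpow_pos_of_pos hu _)
  have hKpos : 0 < K := by
    refine mul_pos hs0 ?_
    rw [setIntegral_pos_iff_support_of_nonneg_ae
      ((ae_restrict_mem measurableSet_Ioi).mono fun u hu => (hgpos u hu).le) hgi]
    have : Function.support g ∩ Set.Ioi 0 = Set.Ioi 0 :=
      Set.inter_eq_right.2 fun u hu => (hgpos u hu).ne'
    rw [this]; simp
  have htail : Tendsto (fun b : ℝ => ∫ u in Set.Ioi b, g u) (𝓝[>] 0)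
      (𝓝 (∫ u in Set.Ioi 0, g u)) := by
    have hz : ∀ b ∈ Set.Ioi (0:ℝ), ∫ u in Set.Ioi b, g u
        = ∫ u in Set.Ioi 0, (Set.Ioi b).indicator g u := fun b hb => by
      rw [setIntegral_indicator measurableSet_Ioi, Set.Ioi_inter_Ioi, sup_eq_right.2 (le_of_lt hb)]
    refine Tendsto.congr' (eventually_nhdsWithin_of_forall fun b hb => (hz b hb).symm) ?_
    refine tendsto_integral_filter_of_dominated_convergence (fun u => ‖g u‖) ?_ ?_ hgi.norm ?_
    · exact Eventually.of_forall fun b => hgi.aestronglyMeasurable.indicator measurableSet_Ioi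
    · exact Eventually.of_forall fun b => Eventually.of_forall fun u =>
        norm_indicator_le_norm_self _ _
    · refine (ae_restrict_mem measurableSet_Ioi).mono fun u hu => ?_
      refine tendsto_const_nhds.congr' ?_
      have : ∀ᶠ b in 𝓝[>] (0:ℝ), b < u := nhdsWithin_le_nhds (Iio_mem_nhds hu)
      filter_upwards [this] with b hb
      rw [Set.indicator_of_mem (by exact hb)]
  -- This normalisation makes N · K · (l b_N)^s equal to l^s for N ≥ 1.
  refine ⟨fun N => (K * N) ^ (-s⁻¹), fun N => by positivity, fun l hl => ?_⟩
  have hb0 : Tendsto (fun N : ℕ => l * (K * N) ^ (-s⁻¹)) atTop (𝓝[>] 0) := by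
    rw [tendsto_nhdsWithin_iff]
    constructor
    · have h1 : Tendsto (fun N : ℕ => K * (N : ℝ)) atTop atTop :=
        tendsto_natCast_atTop_atTop.const_mul_atTop hKpos
      simpa using ((tendsto_rpow_neg_atTop (inv_pos.2 hs0)).comp h1).const_mul l
    · filter_upwards [eventually_gt_atTop 0] with N hN
      have : (0 : ℝ) < N := by exact_mod_cast hN
      exact Set.mem_Ioi.2 (by positivity)
  have hlim := htail.comp hb0
  have key : Tendsto (fun N : ℕ => (N : ℝ) * (-((l * (K * N) ^ (-s⁻¹)) ^ s *
      (s * ∫ u in Set.Ioi (l * (K * N) ^ (-s⁻¹)), g u)))) atTop (𝓝 (-(l ^ s))) := by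
    have h1 : Tendsto (fun N : ℕ => -(l ^ s / K * (s * ∫ u in Set.Ioi (l * (K * N) ^ (-s⁻¹)), g u)))
        atTop (𝓝 (-(l ^ s / K * K))) := ((hlim.const_mul s).const_mul _).neg
    rw [div_mul_cancel₀ _ hKpos.ne'] at h1
    refine h1.congr' ?_
    filter_upwards [eventually_gt_atTop 0] with N hN
    have hN' : (0 : ℝ) < N := by exact_mod_cast hN
    have : (l * (K * N) ^ (-s⁻¹)) ^ s = l ^ s * (K * N)⁻¹ := by
      rw [Real.mul_rpow hl.le (by positivity), ← Real.rpow_mul (by positivity),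
        neg_mul, inv_mul_cancel₀ hs0.ne', Real.rpow_neg_one]
    rw [this]
    field_simp
  have h2 := Real.tendsto_one_add_pow_exp_of_tendsto key
  refine h2.congr' ?_
  filter_upwards [eventually_gt_atTop 0] with N hN
  have hN' : (0 : ℝ) < N := by exact_mod_cast hN
  rw [integral_exp_paretoMeasure_one hs0 (b := l * (K * N) ^ (-s⁻¹)) (by positivity)]
  rw [sub_eq_add_neg]

/-- The element `exp (-∑ max (b xᵢ) 0)` of the unit interval. -/
noncomputable def expNegSum (b : ℝ) (N : ℕ) (x : Fin N → ℝ) : unitInterval :=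
  ⟨Real.exp (-∑ i, max (b * x i) 0), (Real.exp_pos _).le,
    Real.exp_le_one_iff.2 (neg_nonpos.2 (Finset.sum_nonneg fun _ _ => le_max_right _ _))⟩

lemma measurable_expNegSum (b : ℝ) (N : ℕ) : Measurable (expNegSum b N) := by
  refine Measurable.subtype_mk ?_
  fun_prop

/-- Transporting the normalised Pareto sums S_N to [0,1] by q = e^{-S_N} turns Laplace transforms
into moments of continuous functions on a compact space. Probability measures there form a compact
space, so a limit exists without any tightness argument. The truncation by `max` in `expNegSum` only
keeps the values in [0,1]; it is inactive almost surely. -/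
lemma exists_unitInterval_moments {s : ℝ} (hs0 : 0 < s) (hs1 : s < 1) :
    ∃ μ : ProbabilityMeasure unitInterval, ∀ l : ℝ, 0 < l →
      ∫ q, (q : ℝ) ^ l ∂(μ : Measure unitInterval) = Real.exp (-(l ^ s)) := by
  have := ProbabilityTheory.isProbabilityMeasure_paretoMeasure one_pos hs0
  obtain ⟨b, hb, hlim⟩ := tendsto_integral_exp_paretoMeasure_pow hs0 hs1
  let ν : ℕ → ProbabilityMeasure unitInterval := fun N =>
    ⟨(Measure.pi fun _ : Fin N => ProbabilityTheory.paretoMeasure 1 s).map (expNegSum (b N) N),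
      Measure.isProbabilityMeasure_map (measurable_expNegSum _ _).aemeasurable⟩
  have hν : ∀ l : ℝ, 0 < l → ∀ N, ∫ q, (q : ℝ) ^ l ∂(ν N : Measure unitInterval)
      = (∫ x, Real.exp (-(l * b N * x)) ∂(ProbabilityTheory.paretoMeasure 1 s)) ^ N := by
    intro l hl N
    have hc : Continuous fun q : unitInterval => (q : ℝ) ^ l :=
      continuous_subtype_val.rpow_const fun _ => Or.inr hl.le
    change ∫ q, (q : ℝ) ^ l ∂((Measure.pi fun _ : Fin N =>
      ProbabilityTheory.paretoMeasure 1 s).map (expNegSum (b N) N)) = _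
    rw [integral_map (measurable_expNegSum _ _).aemeasurable hc.aestronglyMeasurable]
    have h1 : ∀ x : Fin N → ℝ, ((expNegSum (b N) N x : unitInterval) : ℝ) ^ l
        = ∏ i, Real.exp (-(l * max (b N * x i) 0)) := by
      intro x
      rw [← Real.exp_sum, expNegSum, ← Real.exp_mul, neg_mul, Finset.sum_mul,
        Finset.sum_neg_distrib]
      simp [mul_comm]
    simp_rw [h1]
    rw [integral_fintype_prod_eq_pow (fun x => Real.exp (-(l * max (b N * x) 0))), Fintype.card_fin]
    congr 1
    refine integral_congr_ae ?_
    filter_upwards [ae_paretoMeasure_one_le s] with x hx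
    rw [max_eq_left (mul_nonneg (hb N) (zero_le_one.trans hx)), mul_assoc]
  -- A limit along a free ultrafilter replaces the extraction of a convergent subsequence.
  let μ : ProbabilityMeasure unitInterval := ((hyperfilter ℕ).map ν).lim
  have hμ : Tendsto ν (hyperfilter ℕ) (𝓝 μ) := ((hyperfilter ℕ).map ν).le_nhds_lim
  refine ⟨μ, fun l hl => ?_⟩
  have hc : Continuous fun q : unitInterval => (q : ℝ) ^ l :=
    continuous_subtype_val.rpow_const fun _ => Or.inr hl.le
  have h1 := ProbabilityMeasure.tendsto_iff_forall_integral_tendsto.1 hμ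
    (BoundedContinuousFunction.mkOfCompact ⟨_, hc⟩)
  simp only [BoundedContinuousFunction.mkOfCompact_apply, ContinuousMap.coe_mk, hν l hl] at h1
  refine tendsto_nhds_unique h1 ((hlim l hl).mono_left ?_)
  rw [← Nat.cofinite_eq_atTop]
  exact hyperfilter_le_cofinite

/-- The one-sided `s`-stable law: a probability measure on `(0, ∞)` whose Laplace transform is
`exp (-λ^s)`. -/
lemma exists_stable_law {s : ℝ} (hs0 : 0 < s) (hs1 : s < 1) :
    ∃ μ : Measure ℝ, IsProbabilityMeasure μ ∧ (∀ᵐ τ ∂μ, 0 < τ) ∧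
      ∀ l : ℝ, 0 ≤ l → ∫ τ, Real.exp (-(l * τ)) ∂μ = Real.exp (-(l ^ s)) := by
  obtain ⟨ν, hν⟩ := exists_unitInterval_moments hs0 hs1
  have hbound : ∀ l : ℝ, 0 < l → ∀ q : unitInterval, ‖(q : ℝ) ^ l‖ ≤ 1 := fun l hl q => by
    rw [Real.norm_of_nonneg (Real.rpow_nonneg q.2.1 _)]
    exact Real.rpow_le_one q.2.1 q.2.2 hl.le
  have hmeas : ∀ l : ℝ, Measurable fun q : unitInterval => (q : ℝ) ^ l := fun l => by fun_prop
  -- No mass escapes to τ = ∞: as l → 0, q^l tends to the indicator of q ≠ 0, while the moments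
  -- exp(-l^s) tend to 1.
  have h0 : ∀ᵐ q ∂(ν : Measure unitInterval), q ≠ 0 := by
    have hlim : Tendsto (fun k : ℕ => ∫ q, (q : ℝ) ^ (1 / ((k : ℝ) + 1))
        ∂(ν : Measure unitInterval)) atTop
        (𝓝 (∫ q, ({0}ᶜ : Set unitInterval).indicator (fun _ => (1 : ℝ)) q
          ∂(ν : Measure unitInterval))) := by
      refine tendsto_integral_of_dominated_convergence (fun _ => 1)
        (fun k => (hmeas _).aestronglyMeasurable) (integrable_const _)
        (fun k => ae_of_all _ (hbound _ (by positivity))) (ae_of_all _ fun q => ?_)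
      by_cases hq : q = 0
      · subst hq
        have : ∀ k : ℕ, (((0 : unitInterval) : ℝ)) ^ (1 / ((k : ℝ) + 1)) = 0 := fun k => by
          exact Real.zero_rpow (by positivity)
        simp only [this]
        simp
      · have hq' : (q : ℝ) ≠ 0 := fun h => hq (Subtype.ext h)
        rw [Set.indicator_of_mem (by simpa using hq)]
        have := (Real.continuousAt_const_rpow (b := 0) hq').tendsto.comp
          (tendsto_one_div_add_atTop_nhds_zero_nat (𝕜 := ℝ))
        rw [Real.rpow_zero] at this
        exact this
    have hlim2 : Tendsto (fun k : ℕ => ∫ q, (q : ℝ) ^ (1 / ((k : ℝ) + 1))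
        ∂(ν : Measure unitInterval)) atTop (𝓝 1) := by
      have h1 : ∀ k : ℕ, ∫ q, (q : ℝ) ^ (1 / ((k : ℝ) + 1)) ∂(ν : Measure unitInterval)
          = Real.exp (-((1 / ((k : ℝ) + 1)) ^ s)) := fun k => hν _ (by positivity)
      simp_rw [h1]
      have h2 := ((tendsto_one_div_add_atTop_nhds_zero_nat (𝕜 := ℝ)).rpow_const
        (p := s) (Or.inr hs0.le)).neg.rexp
      simpa [Real.zero_rpow hs0.ne'] using h2
    have h3 := tendsto_nhds_unique hlim hlim2
    rw [integral_indicator_const _ (measurableSet_singleton _).compl, smul_eq_mul, mul_one,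
      probReal_compl_eq_one_sub (measurableSet_singleton _)] at h3
    have h4 : (ν : Measure unitInterval).real {0} = 0 := by linarith
    rw [measureReal_eq_zero_iff] at h4
    rw [ae_iff]
    simpa using h4
  -- No mass at τ = 0: an atom at q = 1 bounds every moment from below, but exp(-l^s) → 0 as l → ∞.
  have h1 : ∀ᵐ q ∂(ν : Measure unitInterval), q ≠ 1 := by
    have hle : ∀ k : ℕ, (ν : Measure unitInterval).real {1} ≤ Real.exp (-(((k : ℝ) + 1) ^ s)) := by
      intro k
      rw [← hν ((k : ℝ) + 1) (by positivity), ← mul_one ((ν : Measure unitInterval).real {1}),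
        ← smul_eq_mul, ← integral_indicator_const _ (measurableSet_singleton _)]
      refine integral_mono ((integrable_const _).indicator (measurableSet_singleton _))
        (Integrable.of_bound (hmeas _).aestronglyMeasurable 1
          (ae_of_all _ (hbound _ (by positivity)))) fun q => ?_
      by_cases hq : q = 1
      · subst hq; simp
      · rw [Set.indicator_of_notMem (by simpa using hq)]
        exact Real.rpow_nonneg q.2.1 _
    have hlim : Tendsto (fun k : ℕ => Real.exp (-(((k : ℝ) + 1) ^ s))) atTop (𝓝 0) := by
      refine Real.tendsto_exp_neg_atTop_nhds_zero.comp ((tendsto_rpow_atTop hs0).comp ?_)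
      exact tendsto_atTop_add_const_right _ _ tendsto_natCast_atTop_atTop
    have h4 : (ν : Measure unitInterval).real {1} = 0 :=
      le_antisymm (ge_of_tendsto' hlim hle) measureReal_nonneg
    rw [measureReal_eq_zero_iff] at h4
    rw [ae_iff]
    simpa using h4
  have hm : Measurable fun q : unitInterval => -Real.log (q : ℝ) := by fun_prop
  refine ⟨(ν : Measure unitInterval).map fun q : unitInterval => -Real.log (q : ℝ),
    Measure.isProbabilityMeasure_map hm.aemeasurable, ?_, fun l hl => ?_⟩
  · rw [ae_map_iff hm.aemeasurable measurableSet_Ioi]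
    filter_upwards [h0, h1] with q hq0 hq1
    have hq0' : (0 : ℝ) < q := lt_of_le_of_ne q.2.1 fun h => hq0 (Subtype.ext h.symm)
    have hq1' : (q : ℝ) < 1 := lt_of_le_of_ne q.2.2 fun h => hq1 (Subtype.ext h)
    exact neg_pos.2 (Real.log_neg hq0' hq1')
  · rcases hl.eq_or_lt with rfl | hl
    · simp [Real.zero_rpow hs0.ne', integral_const]
      have := Measure.isProbabilityMeasure_map (μ := (ν : Measure unitInterval)) hm.aemeasurable
      simp
    · rw [integral_map hm.aemeasurable (by fun_prop), ← hν l hl]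
      refine integral_congr_ae ?_
      filter_upwards [h0] with q hq0
      have hq0' : (0 : ℝ) < q := lt_of_le_of_ne q.2.1 fun h => hq0 (Subtype.ext h.symm)
      rw [Real.rpow_def_of_pos hq0']
      congr 1; ring

/-- A probability measure on `(0, ∞)` whose Laplace transform is `exp (-λ^s)`. -/
structure IsStableLaw (s : ℝ) (μ : Measure ℝ) : Prop where
  prob : IsProbabilityMeasure μ
  pos : ∀ᵐ τ ∂μ, 0 < τ
  laplace : ∀ l : ℝ, 0 ≤ l → ∫ τ, Real.exp (-(l * τ)) ∂μ = Real.exp (-(l ^ s))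

namespace IsStableLaw

variable {s : ℝ} {μ : Measure ℝ}

lemma integrable_exp (h : IsStableLaw s μ) {l : ℝ} (hl : 0 ≤ l) :
    Integrable (fun τ => Real.exp (-(l * τ))) μ := by
  have := h.prob
  refine Integrable.of_bound (C := 1) (by fun_prop) ?_
  filter_upwards [h.pos] with τ hτ
  rw [Real.norm_of_nonneg (Real.exp_pos _).le, Real.exp_le_one_iff]
  have := mul_nonneg hl hτ.le
  linarith

/-- All negative moments of a stable law are finite. -/
lemma integrable_rpow_neg (h : IsStableLaw s μ) (hs : 0 < s) {p : ℝ} (hp : 0 < p) :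
    Integrable (fun τ => τ ^ (-p)) μ := by
  have := h.prob
  -- Since Γ(p) τ^{-p} = ∫ l^{p-1} e^{-lτ} dl, Tonelli's theorem reduces the moment to ∫ l^{p-1}
  -- exp(-l^s) dl, which is finite.
  have hf : Integrable (fun z : ℝ × ℝ => z.2 ^ (p - 1) * Real.exp (-(z.2 * z.1)))
      (μ.prod (volume.restrict (Set.Ioi 0))) := by
    rw [integrable_prod_iff' (by fun_prop)]
    constructor
    · refine (ae_restrict_mem measurableSet_Ioi).mono fun l hl => ?_
      exact (h.integrable_exp (le_of_lt hl)).const_mul (l ^ (p - 1))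
    · refine (integrableOn_rpow_mul_exp_neg_rpow (s := p - 1) (by linarith) hs).congr ?_
      refine (ae_restrict_mem measurableSet_Ioi).mono fun l hl => ?_
      have hl' : (0 : ℝ) < l := hl
      simp only
      rw [← h.laplace l hl'.le, ← integral_const_mul]
      refine integral_congr_ae (ae_of_all _ fun τ => ?_)
      simp only
      rw [Real.norm_of_nonneg (by positivity)]
  have h1 := (hf.integral_prod_left).const_mul (Real.Gamma p)⁻¹
  refine h1.congr ?_
  filter_upwards [h.pos] with τ hτ
  have h2 := Real.integral_rpow_mul_exp_neg_mul_Ioi hp hτ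
  have h3 : ∫ l in Set.Ioi 0, l ^ (p - 1) * Real.exp (-(l * τ))
      = (1 / τ) ^ p * Real.Gamma p := by
    rw [← h2]; simp_rw [mul_comm τ]
  rw [h3, Real.rpow_neg hτ.le, one_div, Real.inv_rpow hτ.le]
  have := (Real.Gamma_pos_of_pos hp).ne'
  field_simp

end IsStableLaw

/-! ### Estimates for mixtures of Gaussians under a stable law -/

lemma rpow_le_mul_exp {z q a : ℝ} (hz : 0 ≤ z) (hq : 0 < q) (ha : 0 < a) :
    z ^ q ≤ (q / a) ^ q * Real.exp (a * z) := by
  have h1 : a * z / q ≤ Real.exp (a * z / q) := by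
    have := Real.add_one_le_exp (a * z / q); linarith
  have h2 : z = q / a * (a * z / q) := by field_simp
  calc z ^ q = (q / a) ^ q * (a * z / q) ^ q := by
        rw [← Real.mul_rpow (by positivity) (by positivity), ← h2]
    _ ≤ (q / a) ^ q * Real.exp (a * z / q) ^ q := by gcongr
    _ = (q / a) ^ q * Real.exp (a * z) := by
        rw [← Real.exp_mul, div_mul_cancel₀ _ hq.ne']

/-- A combination of exponentials, negative near the origin, whose mean under the dilates of an
`s`-stable law is eventually positive if `2 < L ^ (1 - s)`. -/
noncomputable def expComb (L z : ℝ) : ℝ :=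
  (Real.exp (-z) - Real.exp (-(2 * z)))
    - 2 / L * (Real.exp (-(L * z)) - Real.exp (-(2 * L * z)))

lemma hasDerivAt_exp_neg_mul_zero (c : ℝ) :
    HasDerivAt (fun z : ℝ => Real.exp (-(c * z))) (-c) 0 := by
  have h := (((hasDerivAt_id (0 : ℝ)).const_mul c).neg).exp
  simpa using h

/-- The coefficient 2/L makes the derivative at 0 equal to 1 - 2 = -1, whatever L is. -/
lemma expComb_nonpos_near_zero {L : ℝ} (hL : 0 < L) :
    ∃ z0 : ℝ, 0 < z0 ∧ ∀ z, 0 < z → z < z0 → expComb L z ≤ 0 := by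
  have hd : HasDerivAt (expComb L) (-1) 0 := by
    have h := ((hasDerivAt_exp_neg_mul_zero 1).sub (hasDerivAt_exp_neg_mul_zero 2)).sub
      (((hasDerivAt_exp_neg_mul_zero L).sub (hasDerivAt_exp_neg_mul_zero (2 * L))).const_mul
        (2 / L))
    convert! h using 1
    · ext z; simp [expComb]
    · field_simp; ring
  have h0 : expComb L 0 = 0 := by simp [expComb]
  have hs := hd.tendsto_slope_zero_right
  simp only [zero_add, h0, sub_zero, smul_eq_mul] at hs
  have hev := hs.eventually (gt_mem_nhds (show (-1 : ℝ) < 0 by norm_num))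
  rw [eventually_nhdsWithin_iff, Metric.eventually_nhds_iff] at hev
  obtain ⟨e, he, h⟩ := hev
  refine ⟨e, he, fun z hz hze => ?_⟩
  have := h (by rw [Real.dist_eq, sub_zero, abs_of_pos hz]; exact hze) hz
  have h2 : expComb L z = z * (z⁻¹ * expComb L z) := by field_simp
  rw [h2]
  exact (mul_neg_of_pos_of_neg hz this).le

/-- Near 0, where e^{-1/z} degenerates, the left side is nonpositive; away from 0, e^{-1/z} is
bounded below and e^{-z} ≤ p^p z^{-p}. Any lower bound for the mean of `expComb` thus becomes one
for the mean of z^{-p} e^{-1/z}. -/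
lemma expComb_le {L p : ℝ} (hL : 0 < L) (hp : 0 < p) :
    ∃ C : ℝ, 0 < C ∧ ∀ z, 0 < z → expComb L z ≤ C * (z ^ (-p) * Real.exp (-z⁻¹)) := by
  obtain ⟨z0, hz0, h⟩ := expComb_nonpos_near_zero hL
  refine ⟨p ^ p * Real.exp z0⁻¹, by positivity, fun z hz => ?_⟩
  by_cases hzz : z < z0
  · exact (h z hz hzz).trans (by positivity)
  · have h1 : expComb L z ≤ Real.exp (-z) := by
      have a1 := (Real.exp_pos (-(2 * z))).le
      have a2 : Real.exp (-(2 * L * z)) ≤ Real.exp (-(L * z)) :=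
        Real.exp_le_exp.2 (by nlinarith [mul_pos hL hz])
      have a3 : 0 ≤ 2 / L * (Real.exp (-(L * z)) - Real.exp (-(2 * L * z))) :=
        mul_nonneg (by positivity) (by linarith)
      unfold expComb
      linarith
    have h2 := rpow_le_mul_exp hz.le hp one_pos
    rw [div_one, one_mul] at h2
    have h3 : Real.exp (-z0⁻¹) ≤ Real.exp (-z⁻¹) :=
      Real.exp_le_exp.2 (neg_le_neg (inv_anti₀ hz0 (not_lt.1 hzz)))
    have h4 : Real.exp (-z) ≤ p ^ p * z ^ (-p) := by
      rw [Real.exp_neg, Real.rpow_neg hz.le, ← div_eq_mul_inv, inv_eq_one_div,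
        div_le_div_iff₀ (Real.exp_pos _) (by positivity)]
      linarith
    calc expComb L z ≤ Real.exp (-z) := h1
      _ ≤ p ^ p * z ^ (-p) := h4
      _ = p ^ p * z ^ (-p) * (Real.exp z0⁻¹ * Real.exp (-z0⁻¹)) := by
          rw [← Real.exp_add]; simp
      _ ≤ p ^ p * z ^ (-p) * (Real.exp z0⁻¹ * Real.exp (-z⁻¹)) := by gcongr
      _ = _ := by ring

namespace IsStableLaw

variable {s : ℝ} {μ : Measure ℝ}

lemma integrable_expComb (h : IsStableLaw s μ) {L A : ℝ} (hL : 0 ≤ L) (hA : 0 ≤ A) :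
    Integrable (fun τ => expComb L (A⁻¹ * τ)) μ := by
  have i1 := h.integrable_exp (l := A⁻¹) (by positivity)
  have i2 := h.integrable_exp (l := 2 * A⁻¹) (by positivity)
  have i3 := h.integrable_exp (l := L * A⁻¹) (by positivity)
  have i4 := h.integrable_exp (l := 2 * L * A⁻¹) (by positivity)
  refine ((i1.sub i2).sub ((i3.sub i4).const_mul (2 / L))).congr (ae_of_all _ fun τ => ?_)
  simp [expComb, mul_assoc]

lemma integral_expComb (h : IsStableLaw s μ) {L A : ℝ} (hL : 0 ≤ L) (hA : 0 < A) :
    ∫ τ, expComb L (A⁻¹ * τ) ∂μ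
      = (Real.exp (-(1 * A ^ (-s))) - Real.exp (-(2 ^ s * A ^ (-s))))
        - 2 / L * (Real.exp (-(L ^ s * A ^ (-s))) - Real.exp (-((2 * L) ^ s * A ^ (-s)))) := by
  have i1 := h.integrable_exp (l := A⁻¹) (by positivity)
  have i2 := h.integrable_exp (l := 2 * A⁻¹) (by positivity)
  have i3 := h.integrable_exp (l := L * A⁻¹) (by positivity)
  have i4 := h.integrable_exp (l := 2 * L * A⁻¹) (by positivity)
  have hAs : A⁻¹ ^ s = A ^ (-s) := by rw [Real.inv_rpow hA.le, Real.rpow_neg hA.le]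
  have hc : ∀ c : ℝ, 0 ≤ c → (c * A⁻¹) ^ s = c ^ s * A ^ (-s) := fun c hc => by
    rw [Real.mul_rpow hc (by positivity), hAs]
  have e : ∀ τ, expComb L (A⁻¹ * τ) = (Real.exp (-(A⁻¹ * τ)) - Real.exp (-(2 * A⁻¹ * τ)))
      - 2 / L * (Real.exp (-(L * A⁻¹ * τ)) - Real.exp (-(2 * L * A⁻¹ * τ))) := fun τ => by
    simp [expComb, mul_assoc]
  simp_rw [e]
  have i12 : Integrable (fun τ => Real.exp (-(A⁻¹ * τ)) - Real.exp (-(2 * A⁻¹ * τ))) μ := i1.sub i2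
  have i34 : Integrable (fun τ =>
    2 / L * (Real.exp (-(L * A⁻¹ * τ)) - Real.exp (-(2 * L * A⁻¹ * τ)))) μ :=
    (i3.sub i4).const_mul (2 / L)
  rw [integral_sub i12 i34, integral_sub i1 i2,
    integral_const_mul, integral_sub i3 i4, h.laplace _ (by positivity),
    h.laplace _ (by positivity), h.laplace _ (by positivity), h.laplace _ (by positivity),
    hc _ zero_le_two, hc _ hL, hc _ (by positivity), hAs, one_mul]

/-- By the Laplace transform, the mean of `expComb L (τ/A)` is f(A^{-s}) for a smooth f with f(0) =
0 and f'(0) = (2^s - 1)(1 - 2L^{s-1}). The exponent s has replaced the slopes 1, 2, L, 2L by their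
s-th powers, and this makes the derivative positive for large L, although that of `expComb` itself
is negative. -/
lemma exists_lower_bound (h : IsStableLaw s μ) (hs0 : 0 < s) (hs1 : s < 1) {p : ℝ} (hp : 0 < p) :
    ∃ c A₁ : ℝ, 0 < c ∧ 0 < A₁ ∧ ∀ A, A₁ ≤ A →
      c * A ^ (-p - s) ≤ ∫ τ, τ ^ (-p) * Real.exp (-(A / τ)) ∂μ := by
  -- Here s < 1 is decisive: L^{1-s} is unbounded.
  obtain ⟨L, hL1, hL⟩ : ∃ L : ℝ, 1 ≤ L ∧ 2 < L ^ (1 - s) :=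
    (((tendsto_rpow_atTop (show 0 < 1 - s by linarith)).eventually_gt_atTop 2).and
      (eventually_ge_atTop 1)).exists.imp fun L h => ⟨h.2, h.1⟩
  have hL0 : 0 < L := by linarith
  set f : ℝ → ℝ := fun x => (Real.exp (-(1 * x)) - Real.exp (-(2 ^ s * x)))
        - 2 / L * (Real.exp (-(L ^ s * x)) - Real.exp (-((2 * L) ^ s * x))) with hf
  set d : ℝ := (2 ^ s - 1) * (1 - 2 / L * L ^ s) with hd
  have hdpos : 0 < d := by
    refine mul_pos (sub_pos.2 (Real.one_lt_rpow one_lt_two hs0)) ?_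
    have e1 : L ^ (1 - s) * L ^ s = L := by rw [← Real.rpow_add hL0]; simp
    have e2 : 0 < L ^ s := Real.rpow_pos_of_pos hL0 s
    have : 2 / L * L ^ s < 1 := by
      rw [div_mul_eq_mul_div, div_lt_one hL0]
      nlinarith
    linarith
  have hderiv : HasDerivAt f d 0 := by
    have h := ((hasDerivAt_exp_neg_mul_zero 1).sub (hasDerivAt_exp_neg_mul_zero (2 ^ s))).sub
      (((hasDerivAt_exp_neg_mul_zero (L ^ s)).sub
        (hasDerivAt_exp_neg_mul_zero ((2 * L) ^ s))).const_mul (2 / L))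
    convert! h using 1
    rw [hd, Real.mul_rpow zero_le_two hL0.le]
    ring
  have hf0 : f 0 = 0 := by simp [hf]
  have hsl := hderiv.tendsto_slope_zero_right
  simp only [zero_add, hf0, sub_zero, smul_eq_mul] at hsl
  have hev := hsl.eventually (lt_mem_nhds (show d / 2 < d by linarith))
  have hA0 : Tendsto (fun A : ℝ => A ^ (-s)) atTop (𝓝[>] 0) := by
    rw [tendsto_nhdsWithin_iff]
    refine ⟨tendsto_rpow_neg_atTop hs0, ?_⟩
    filter_upwards [eventually_gt_atTop 0] with A hA
    exact Real.rpow_pos_of_pos hA _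
  obtain ⟨A₁, hA₁⟩ := eventually_atTop.1 ((hA0.eventually hev).and (eventually_gt_atTop 0))
  obtain ⟨C, hC, hCle⟩ := expComb_le hL0 hp
  refine ⟨d / 2 / C, A₁, by positivity, (hA₁ A₁ le_rfl).2, fun A hA => ?_⟩
  have hApos : 0 < A := (hA₁ A hA).2
  have hx : 0 < A ^ (-s) := Real.rpow_pos_of_pos hApos _
  have h1 : d / 2 * A ^ (-s) ≤ f (A ^ (-s)) := by
    have h2 := (hA₁ A hA).1
    rw [inv_mul_eq_div, lt_div_iff₀ hx] at h2
    exact h2.le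
  have hint : Integrable (fun τ => τ ^ (-p) * Real.exp (-(A / τ))) μ := by
    refine (h.integrable_rpow_neg hs0 hp).mono' (by fun_prop) ?_
    filter_upwards [h.pos] with τ hτ
    rw [Real.norm_of_nonneg (by positivity)]
    have : Real.exp (-(A / τ)) ≤ 1 := Real.exp_le_one_iff.2 (neg_nonpos.2 (by positivity))
    exact mul_le_of_le_one_right (by positivity) this
  have h3 : ∫ τ, expComb L (A⁻¹ * τ) ∂μ
      ≤ ∫ τ, C * A ^ p * (τ ^ (-p) * Real.exp (-(A / τ))) ∂μ := by
    refine integral_mono_ae (h.integrable_expComb hL0.le hApos.le) (hint.const_mul _) ?_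
    filter_upwards [h.pos] with τ hτ
    refine (hCle (A⁻¹ * τ) (by positivity)).trans_eq ?_
    rw [Real.mul_rpow (by positivity) hτ.le, Real.inv_rpow hApos.le, Real.rpow_neg hApos.le,
      inv_inv, mul_inv, inv_inv, div_eq_mul_inv]
    ring
  rw [h.integral_expComb hL0.le hApos, integral_const_mul] at h3
  have h4 : d / 2 * A ^ (-s) ≤ C * A ^ p * ∫ τ, τ ^ (-p) * Real.exp (-(A / τ)) ∂μ := h1.trans h3
  have hAp : 0 < A ^ p := Real.rpow_pos_of_pos hApos _
  rw [sub_eq_add_neg, Real.rpow_add hApos, Real.rpow_neg hApos.le p]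
  calc d / 2 / C * ((A ^ p)⁻¹ * A ^ (-s)) = (d / 2 * A ^ (-s)) / (C * A ^ p) := by
        field_simp
    _ ≤ _ := by rw [div_le_iff₀ (by positivity)]; linarith

end IsStableLaw

/-- The radial profile of a mixture of Gaussians: `∫ τ^{-p} exp (-r²/4τ) dμ(τ)`. -/
noncomputable def gaussMix (μ : Measure ℝ) (p r : ℝ) : ℝ :=
  ∫ τ, τ ^ (-p) * Real.exp (-(r ^ 2 / (4 * τ))) ∂μ

/-- The first term is a relative error, harmless after integration; the second is not relative, but
decays exponentially in r. -/
lemma abs_exp_neg_sub_exp_neg_le {r r' τ : ℝ} (hr : 0 ≤ r) (hr' : 0 ≤ r') (hrr : |r - r'| ≤ 1)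
    (hτ : 0 < τ) :
    |Real.exp (-(r ^ 2 / (4 * τ))) - Real.exp (-(r' ^ 2 / (4 * τ)))|
      ≤ |r - r'| * (Real.exp (-(r ^ 2 / (4 * τ)))
        + (1 + r) * Real.exp (-((r - 3) / 4)) * τ⁻¹) := by
  set a := r ^ 2 / (4 * τ) with ha
  set b := r' ^ 2 / (4 * τ) with hb
  have habs := abs_le.1 hrr
  have hab : |a - b| ≤ |r - r'| * ((1 + r) / (2 * τ)) := by
    have : a - b = (r - r') * ((r + r') / (4 * τ)) := by rw [ha, hb]; field_simp; ring
    rw [this, abs_mul, abs_of_nonneg (by positivity : 0 ≤ (r + r') / (4 * τ))]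
    refine mul_le_mul_of_nonneg_left ?_ (abs_nonneg _)
    rw [div_le_div_iff₀ (by positivity) (by positivity)]
    nlinarith
  -- For τ ≥ 1 + r the exponents differ by at most |r - r'|/2. For τ < 1 + r both are at least
  -- (r-3)/4, because (r-1)² ≥ (r-3)(r+1).
  by_cases hcase : 1 + r ≤ τ
  · have h1 : |a - b| ≤ |r - r'| / 2 := by
      refine hab.trans ?_
      rw [div_eq_mul_one_div |r - r'|]
      gcongr ?_ * ?_
      rw [div_le_div_iff₀ (by positivity) two_pos]
      linarith
    have h2 : |Real.exp (a - b) - 1| ≤ 2 * |a - b| :=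
      Real.abs_exp_sub_one_le (by linarith)
    have h3 : Real.exp (-a) - Real.exp (-b) = -(Real.exp (-a) * (Real.exp (a - b) - 1)) := by
      rw [mul_sub, ← Real.exp_add]; ring_nf
    rw [h3, abs_neg, abs_mul, abs_of_pos (Real.exp_pos _)]
    have h4 : 0 ≤ (1 + r) * Real.exp (-((r - 3) / 4)) * τ⁻¹ := by positivity
    calc Real.exp (-a) * |Real.exp (a - b) - 1| ≤ Real.exp (-a) * |r - r'| := by
          refine mul_le_mul_of_nonneg_left ?_ (Real.exp_pos _).le
          linarith
      _ = |r - r'| * Real.exp (-a) := mul_comm _ _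
      _ ≤ _ := by gcongr; linarith
  · have hτr : τ < 1 + r := not_le.1 hcase
    have hmin : ∀ x : ℝ, 0 ≤ x → r - 1 ≤ x → (r - 3) / 4 ≤ x ^ 2 / (4 * τ) := by
      intro x hx hx1
      rcases le_or_gt r 3 with h3 | h3
      · have : 0 ≤ x ^ 2 / (4 * τ) := by positivity
        linarith
      · rw [div_le_div_iff₀ (by norm_num) (by positivity)]
        nlinarith
    have hexp : ∀ x y m : ℝ, m ≤ x → m ≤ y →
        |Real.exp (-x) - Real.exp (-y)| ≤ |x - y| * Real.exp (-m) := by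
      have key : ∀ x y m : ℝ, x ≤ y → m ≤ x →
          |Real.exp (-x) - Real.exp (-y)| ≤ |x - y| * Real.exp (-m) := by
        intro x y m hxy hmx
        have e1 : Real.exp (-y) = Real.exp (-x) * Real.exp (x - y) := by
          rw [← Real.exp_add]; ring_nf
        have e2 := Real.add_one_le_exp (x - y)
        have e3 : Real.exp (-x) ≤ Real.exp (-m) := Real.exp_le_exp.2 (by linarith)
        have e4 := Real.exp_pos (-x)
        have e5 : Real.exp (-y) ≤ Real.exp (-x) := Real.exp_le_exp.2 (by linarith)
        rw [abs_of_nonneg (by linarith), abs_of_nonpos (by linarith), e1]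
        nlinarith
      intro x y m hx hy
      rcases le_total x y with hxy | hxy
      · exact key x y m hxy hx
      · rw [abs_sub_comm, abs_sub_comm x y]; exact key y x m hxy hy
    have h5 := hexp a b ((r - 3) / 4) (hmin r hr (by linarith)) (hmin r' hr' (by linarith))
    calc |Real.exp (-a) - Real.exp (-b)| ≤ |a - b| * Real.exp (-((r - 3) / 4)) := h5
      _ ≤ |r - r'| * ((1 + r) / (2 * τ)) * Real.exp (-((r - 3) / 4)) := by gcongr
      _ = |r - r'| * ((1 + r) * Real.exp (-((r - 3) / 4)) * τ⁻¹) / 2 := by field_simp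
      _ ≤ |r - r'| * ((1 + r) * Real.exp (-((r - 3) / 4)) * τ⁻¹) :=
          half_le_self (by positivity)
      _ ≤ _ := by
          have := Real.exp_pos (-a)
          gcongr; linarith

namespace IsStableLaw

variable {s : ℝ} {μ : Measure ℝ}

lemma integrable_gaussMix (h : IsStableLaw s μ) (hs0 : 0 < s) {p : ℝ} (hp : 0 < p) (r : ℝ) :
    Integrable (fun τ => τ ^ (-p) * Real.exp (-(r ^ 2 / (4 * τ)))) μ := by
  refine (h.integrable_rpow_neg hs0 hp).mono' (by fun_prop) ?_
  filter_upwards [h.pos] with τ hτ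
  rw [Real.norm_of_nonneg (by positivity)]
  exact mul_le_of_le_one_right (by positivity)
    (Real.exp_le_one_iff.2 (neg_nonpos.2 (by positivity)))

/-- The tail bound at A comparable to (1 + r)², which doubles the exponent p + s. The factor A₁ + 1
brings every r ≥ 0 into the admissible range. -/
lemma exists_gaussMix_lower_bound (h : IsStableLaw s μ) (hs0 : 0 < s) (hs1 : s < 1) {p : ℝ}
    (hp : 0 < p) :
    ∃ c q : ℝ, 0 < c ∧ 0 < q ∧ ∀ r, 0 ≤ r → c * (1 + r) ^ (-q) ≤ gaussMix μ p r := by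
  obtain ⟨c, A₁, hc, hA₁, hle⟩ := h.exists_lower_bound hs0 hs1 hp
  have hpos : 0 < A₁ + 1 := by linarith
  refine ⟨c * (A₁ + 1) ^ (-p - s), 2 * (p + s), by positivity, by positivity, fun r hr => ?_⟩
  have h1 : A₁ ≤ (A₁ + 1) * (1 + r) ^ 2 := by
    nlinarith [mul_nonneg hpos.le hr, mul_nonneg hpos.le (sq_nonneg r)]
  have h2 : c * (A₁ + 1) ^ (-p - s) * (1 + r) ^ (-(2 * (p + s)))
      = c * ((A₁ + 1) * (1 + r) ^ 2) ^ (-p - s) := by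
    rw [Real.mul_rpow hpos.le (by positivity), ← Real.rpow_natCast (1 + r) 2,
      ← Real.rpow_mul (by positivity)]
    push_cast
    ring_nf
  rw [h2]
  refine (hle _ h1).trans (integral_mono_of_nonneg ?_ (h.integrable_gaussMix hs0 hp r) ?_)
  · filter_upwards [h.pos] with τ hτ
    exact by positivity
  · filter_upwards [h.pos] with τ hτ
    refine mul_le_mul_of_nonneg_left (Real.exp_le_exp.2 (neg_le_neg ?_)) (by positivity)
    rw [div_le_div_iff₀ (by positivity) hτ]
    have : r ^ 2 ≤ (A₁ + 1) * (1 + r) ^ 2 * 4 := by nlinarith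
    nlinarith

lemma gaussMix_pos (h : IsStableLaw s μ) (hs0 : 0 < s) (hs1 : s < 1) {p r : ℝ}
    (hp : 0 < p) (hr : 0 ≤ r) : 0 < gaussMix μ p r := by
  obtain ⟨c, q, hc, hq, hle⟩ := h.exists_gaussMix_lower_bound hs0 hs1 hp
  exact lt_of_lt_of_le (by positivity) (hle r hr)

/-- The logarithm of the profile is Lipschitz at unit scale. -/
lemma exists_abs_gaussMix_sub_le (h : IsStableLaw s μ) (hs0 : 0 < s) (hs1 : s < 1) {p : ℝ}
    (hp : 0 < p) :
    ∃ C : ℝ, 0 < C ∧ ∀ r r' : ℝ, 0 ≤ r → 0 ≤ r' → |r - r'| ≤ 1 →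
      |gaussMix μ p r' - gaussMix μ p r| ≤ C * |r - r'| * gaussMix μ p r := by
  obtain ⟨c, q, hc, hq, hle⟩ := h.exists_gaussMix_lower_bound hs0 hs1 hp
  have hmom := h.integrable_rpow_neg hs0 (p := p + 1) (by positivity)
  set m := ∫ τ, τ ^ (-(p + 1)) ∂μ with hm
  have hm0 : 0 ≤ m := integral_nonneg_of_ae (by
    filter_upwards [h.pos] with τ hτ; exact Real.rpow_nonneg hτ.le _)
  -- From z^{q+1} ≤ (4(q+1))^{q+1} e^{z/4} at z = 1 + r; the factor e accounts for (r-3)/4 = (1+r)/4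
  -- - 1.
  set D := ((q + 1) / (1 / 4)) ^ (q + 1) * Real.exp 1 with hD
  have hD0 : 0 < D := by positivity
  refine ⟨1 + m * D / c, by positivity, fun r r' hr hr' hrr => ?_⟩
  have hpt : ∀ᵐ τ ∂μ, ‖τ ^ (-p) * Real.exp (-(r' ^ 2 / (4 * τ)))
        - τ ^ (-p) * Real.exp (-(r ^ 2 / (4 * τ)))‖
      ≤ |r - r'| * (τ ^ (-p) * Real.exp (-(r ^ 2 / (4 * τ)))
        + (1 + r) * Real.exp (-((r - 3) / 4)) * τ ^ (-(p + 1))) := by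
    filter_upwards [h.pos] with τ hτ
    rw [← mul_sub, norm_mul, Real.norm_of_nonneg (by positivity), Real.norm_eq_abs, abs_sub_comm]
    have e : τ ^ (-(p + 1)) = τ ^ (-p) * τ⁻¹ := by
      rw [neg_add, Real.rpow_add hτ, Real.rpow_neg_one]
    rw [e]
    calc _ ≤ τ ^ (-p) * (|r - r'| * (Real.exp (-(r ^ 2 / (4 * τ)))
        + (1 + r) * Real.exp (-((r - 3) / 4)) * τ⁻¹)) := by
          gcongr; exact abs_exp_neg_sub_exp_neg_le hr hr' hrr hτ
      _ = _ := by ring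
  have i1 := h.integrable_gaussMix hs0 hp r
  have i2 := h.integrable_gaussMix hs0 hp r'
  have h1 : |gaussMix μ p r' - gaussMix μ p r|
      ≤ |r - r'| * (gaussMix μ p r + (1 + r) * Real.exp (-((r - 3) / 4)) * m) := by
    rw [gaussMix, gaussMix, ← integral_sub i2 i1, ← Real.norm_eq_abs]
    refine (norm_integral_le_of_norm_le ((i1.add (hmom.const_mul _)).const_mul _) hpt).trans_eq ?_
    rw [integral_const_mul]
    simp only [Pi.add_apply]
    rw [integral_add i1 (hmom.const_mul _), integral_const_mul]
  have h2 : (1 + r) * Real.exp (-((r - 3) / 4)) ≤ D / c * gaussMix μ p r := by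
    have e1 := rpow_le_mul_exp (z := 1 + r) (q := q + 1) (a := 1 / 4) (by positivity)
      (by positivity) (by positivity)
    have e2 : Real.exp (-((r - 3) / 4)) = Real.exp 1 * Real.exp (-(1 / 4 * (1 + r))) := by
      rw [← Real.exp_add]; ring_nf
    have e3 : (1 + r) * Real.exp (-(1 / 4 * (1 + r)))
        ≤ ((q + 1) / (1 / 4)) ^ (q + 1) * (1 + r) ^ (-q) := by
      have e4 : (1 + r) = (1 + r) ^ (q + 1) * (1 + r) ^ (-q) := by
        rw [← Real.rpow_add (by positivity)]; simp
      calc (1 + r) * Real.exp (-(1 / 4 * (1 + r)))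
          = (1 + r) ^ (q + 1) * (1 + r) ^ (-q) * Real.exp (-(1 / 4 * (1 + r))) := by rw [← e4]
        _ ≤ (((q + 1) / (1 / 4)) ^ (q + 1) * Real.exp (1 / 4 * (1 + r))) * (1 + r) ^ (-q)
            * Real.exp (-(1 / 4 * (1 + r))) := by gcongr
        _ = ((q + 1) / (1 / 4)) ^ (q + 1) * (1 + r) ^ (-q)
            * (Real.exp (1 / 4 * (1 + r)) * Real.exp (-(1 / 4 * (1 + r)))) := by ring
        _ = _ := by rw [← Real.exp_add]; simp
    calc (1 + r) * Real.exp (-((r - 3) / 4))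
        = Real.exp 1 * ((1 + r) * Real.exp (-(1 / 4 * (1 + r)))) := by rw [e2]; ring
      _ ≤ Real.exp 1 * (((q + 1) / (1 / 4)) ^ (q + 1) * (1 + r) ^ (-q)) := by gcongr
      _ = D / c * (c * (1 + r) ^ (-q)) := by rw [hD]; field_simp
      _ ≤ D / c * gaussMix μ p r := by gcongr; exact hle r hr
  calc _ ≤ _ := h1
    _ ≤ |r - r'| * (gaussMix μ p r + D / c * gaussMix μ p r * m) := by gcongr
    _ = _ := by ring

end IsStableLaw

/-! ### The fundamental solution -/

/-- The symbol `exp (-t |2πξ|^{2s})`. -/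
noncomputable def heatSymbol {n : ℕ} (s t : ℝ) (ξ : EuclideanSpace ℝ (Fin n)) : ℝ :=
  Real.exp (-(t * (2 * Real.pi * ‖ξ‖) ^ (2 * s)))

lemma heatSymbol_nonneg {n : ℕ} (s t : ℝ) (ξ : EuclideanSpace ℝ (Fin n)) :
    0 ≤ heatSymbol s t ξ := (Real.exp_pos _).le

lemma heatSymbol_le_one {n : ℕ} {s t : ℝ} (ht : 0 ≤ t) (ξ : EuclideanSpace ℝ (Fin n)) :
    heatSymbol s t ξ ≤ 1 := Real.exp_le_one_iff.2 (neg_nonpos.2 (by positivity))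

lemma integrable_heatSymbol {n : ℕ} (hn : 1 ≤ n) {s t : ℝ} (hs : 0 < s) (ht : 0 < t) :
    Integrable (heatSymbol s t : EuclideanSpace ℝ (Fin n) → ℝ) := by
  have : Nonempty (Fin n) := ⟨⟨0, hn⟩⟩
  have h := (integrable_fun_norm_addHaar (volume : Measure (EuclideanSpace ℝ (Fin n)))
    (f := fun r : ℝ => Real.exp (-(t * (2 * Real.pi * r) ^ (2 * s))))).2 ?_
  · exact h
  · have h0 := Nat.cast_nonneg (α := ℝ) (Module.finrank ℝ (EuclideanSpace ℝ (Fin n)) - 1)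
    have h2 := integrableOn_rpow_mul_exp_neg_mul_rpow
      (p := 2 * s) (s := ((Module.finrank ℝ (EuclideanSpace ℝ (Fin n)) - 1 : ℕ) : ℝ))
      (b := t * (2 * Real.pi) ^ (2 * s)) (by linarith) (by positivity) (by positivity)
    refine h2.congr ((ae_restrict_mem measurableSet_Ioi).mono fun r hr => ?_)
    have hr' : (0 : ℝ) < r := hr
    simp only [Real.rpow_natCast, smul_eq_mul]
    rw [Real.mul_rpow (by positivity) hr'.le]
    ring_nf

lemma fourierInv_heatSymbol_one {n : ℕ} {t : ℝ} (ht : 0 < t) (x : EuclideanSpace ℝ (Fin n)) :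
    𝓕⁻ (fun ξ : EuclideanSpace ℝ (Fin n) => ((heatSymbol 1 t ξ : ℝ) : ℂ)) x
      = (((4 * Real.pi * t) ^ (-((n : ℝ) / 2)) * Real.exp (-(‖x‖ ^ 2 / (4 * t))) : ℝ) : ℂ) := by
  have hb : 0 < (((4 * Real.pi ^ 2 * t : ℝ)) : ℂ).re := by
    rw [Complex.ofReal_re]; positivity
  have h := fourier_gaussian_innerProductSpace hb (-x)
  rw [Real.fourierInv_eq_fourier_neg]
  have e : (fun ξ : EuclideanSpace ℝ (Fin n) => ((heatSymbol 1 t ξ : ℝ) : ℂ))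
      = fun v => Complex.exp (-((4 * Real.pi ^ 2 * t : ℝ) : ℂ) * (‖v‖ : ℂ) ^ 2) := by
    ext ξ
    rw [heatSymbol, show (2 : ℝ) * 1 = ((2 : ℕ) : ℝ) by norm_num, Real.rpow_natCast]
    push_cast
    congr 1; ring
  rw [e, h, finrank_euclideanSpace, Fintype.card_fin, norm_neg]
  have hpi : (Real.pi : ℂ) ≠ 0 := by exact_mod_cast Real.pi_ne_zero
  have ht' : (t : ℂ) ≠ 0 := by exact_mod_cast ht.ne'
  have e1 : (Real.pi : ℂ) / ((4 * Real.pi ^ 2 * t : ℝ) : ℂ) = (((4 * Real.pi * t)⁻¹ : ℝ) : ℂ) := by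
    push_cast; field_simp
  have e2 : (n : ℂ) / 2 = (((n : ℝ) / 2 : ℝ) : ℂ) := by push_cast; rfl
  rw [e1, e2, ← Complex.ofReal_cpow (by positivity), Real.inv_rpow (by positivity),
    ← Real.rpow_neg (by positivity)]
  push_cast
  congr 2
  field_simp

lemma heatKernel_one {n : ℕ} {t : ℝ} (ht : 0 < t) (x : EuclideanSpace ℝ (Fin n)) :
    heatKernel 1 t x = (4 * Real.pi * t) ^ (-((n : ℝ) / 2)) * Real.exp (-(‖x‖ ^ 2 / (4 * t))) := by
  have h := fourierInv_heatSymbol_one ht x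
  unfold heatSymbol at h
  rw [heatKernel, h, Complex.ofReal_re]

/-- Subordination: the fractional kernel is a mixture of Gaussians. -/
lemma fourierInv_heatSymbol {n : ℕ} (hn : 1 ≤ n) {s : ℝ} {μ : Measure ℝ} (h : IsStableLaw s μ)
    (hs : 0 < s) {t : ℝ} (ht : 0 < t) (x : EuclideanSpace ℝ (Fin n)) :
    𝓕⁻ (fun ξ : EuclideanSpace ℝ (Fin n) => ((heatSymbol s t ξ : ℝ) : ℂ)) x
      = (((4 * Real.pi * t ^ (1 / s)) ^ (-((n : ℝ) / 2))
          * gaussMix μ ((n : ℝ) / 2) (‖x‖ / t ^ (1 / (2 * s))) : ℝ) : ℂ) := by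
  have := h.prob
  -- Chosen so that (θ|2πξ|²)^s = t|2πξ|^{2s}: the symbol is then the average over μ of the Gaussian
  -- symbols at times θτ, and Fubini moves the average outside the inverse transform.
  set θ : ℝ := t ^ (1 / s) with hθ
  have hθ0 : 0 < θ := by positivity
  have hlap : ∀ ξ : EuclideanSpace ℝ (Fin n), ∫ τ, heatSymbol 1 (θ * τ) ξ ∂μ = heatSymbol s t ξ := by
    intro ξ
    have e1 : ∀ τ, heatSymbol 1 (θ * τ) ξ = Real.exp (-(θ * (2 * Real.pi * ‖ξ‖) ^ 2 * τ)) := by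
      intro τ
      rw [heatSymbol, show (2 : ℝ) * 1 = ((2 : ℕ) : ℝ) by norm_num, Real.rpow_natCast]
      ring_nf
    simp_rw [e1]
    rw [h.laplace _ (by positivity), heatSymbol, Real.mul_rpow hθ0.le (by positivity), hθ,
      ← Real.rpow_mul ht.le, one_div_mul_cancel hs.ne', Real.rpow_one, Real.rpow_mul (by positivity),
      Real.rpow_two]
  have hmeas : Measurable fun z : EuclideanSpace ℝ (Fin n) × ℝ => heatSymbol 1 (θ * z.2) z.1 := by
    unfold heatSymbol; fun_prop
  have hint : Integrable (fun z : EuclideanSpace ℝ (Fin n) × ℝ => heatSymbol 1 (θ * z.2) z.1)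
      (volume.prod μ) := by
    rw [integrable_prod_iff hmeas.aestronglyMeasurable]
    constructor
    · refine ae_of_all _ fun ξ => ?_
      refine Integrable.of_bound (C := 1)
        (hmeas.comp measurable_prodMk_left).aestronglyMeasurable ?_
      filter_upwards [h.pos] with τ hτ
      rw [Real.norm_of_nonneg (heatSymbol_nonneg _ _ _)]
      exact heatSymbol_le_one (by positivity) ξ
    · refine (integrable_heatSymbol hn hs ht).congr (ae_of_all _ fun ξ => ?_)
      simp only [Real.norm_of_nonneg (heatSymbol_nonneg _ _ _)]
      rw [hlap]
  have hint2 : Integrable (Function.uncurry fun (ξ : EuclideanSpace ℝ (Fin n)) (τ : ℝ) =>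
      (𝐞 (inner ℝ ξ x) : ℂ) * ((heatSymbol 1 (θ * τ) ξ : ℝ) : ℂ)) (volume.prod μ) := by
    refine hint.mono ?_ ?_
    · refine AEStronglyMeasurable.mul ?_
        (Complex.measurable_ofReal.comp hmeas).aestronglyMeasurable
      exact Continuous.aestronglyMeasurable (by fun_prop)
    · refine ae_of_all _ fun z => ?_
      simp only [Function.uncurry, norm_mul]
      rw [Circle.norm_coe, one_mul, Complex.norm_real]
  have e2 : ∀ ξ : EuclideanSpace ℝ (Fin n), (𝐞 (inner ℝ ξ x)) • ((heatSymbol s t ξ : ℝ) : ℂ)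
      = ∫ τ, (𝐞 (inner ℝ ξ x) : ℂ) * ((heatSymbol 1 (θ * τ) ξ : ℝ) : ℂ) ∂μ := by
    intro ξ
    rw [integral_const_mul, integral_complex_ofReal, hlap, Circle.smul_def, smul_eq_mul]
  rw [Real.fourierInv_eq]
  simp_rw [e2]
  rw [integral_integral_swap hint2]
  have e3 : ∀ᵐ τ ∂μ, ∫ ξ : EuclideanSpace ℝ (Fin n),
      (𝐞 (inner ℝ ξ x) : ℂ) * ((heatSymbol 1 (θ * τ) ξ : ℝ) : ℂ)
      = (((4 * Real.pi * θ) ^ (-((n : ℝ) / 2)) * (τ ^ (-((n : ℝ) / 2))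
        * Real.exp (-((‖x‖ / t ^ (1 / (2 * s))) ^ 2 / (4 * τ)))) : ℝ) : ℂ) := by
    filter_upwards [h.pos] with τ hτ
    have e4 := fourierInv_heatSymbol_one (mul_pos hθ0 hτ) x
    rw [Real.fourierInv_eq] at e4
    simp_rw [Circle.smul_def, smul_eq_mul] at e4
    rw [e4, ← mul_assoc, Real.mul_rpow (by positivity) hτ.le, mul_assoc]
    have e5 : (t ^ (1 / (2 * s))) ^ 2 = θ := by
      rw [hθ, ← Real.rpow_natCast, ← Real.rpow_mul ht.le]
      congr 1
      push_cast
      field_simp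
    rw [div_pow, e5]
    congr 4
    field_simp
  rw [integral_congr_ae e3, integral_complex_ofReal, integral_const_mul, gaussMix]

lemma heatKernel_eq {n : ℕ} (hn : 1 ≤ n) {s : ℝ} {μ : Measure ℝ} (h : IsStableLaw s μ)
    (hs : 0 < s) {t : ℝ} (ht : 0 < t) (x : EuclideanSpace ℝ (Fin n)) :
    heatKernel s t x = (4 * Real.pi * t ^ (1 / s)) ^ (-((n : ℝ) / 2))
          * gaussMix μ ((n : ℝ) / 2) (‖x‖ / t ^ (1 / (2 * s))) := by
  have e := fourierInv_heatSymbol hn h hs ht x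
  unfold heatSymbol at e
  rw [heatKernel, e, Complex.ofReal_re]

/-- The inverse transform of the symbol is the (real) kernel. -/
lemma fourierInv_heatSymbol_eq_heatKernel {n : ℕ} (hn : 1 ≤ n) {s : ℝ} (hs0 : 0 < s) (hs1 : s < 1)
    {t : ℝ} (ht : 0 < t) (x : EuclideanSpace ℝ (Fin n)) :
    𝓕⁻ (fun ξ : EuclideanSpace ℝ (Fin n) => ((heatSymbol s t ξ : ℝ) : ℂ)) x
      = ((heatKernel s t x : ℝ) : ℂ) := by
  obtain ⟨μ, h1, h2, h3⟩ := exists_stable_law hs0 hs1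
  have h : IsStableLaw s μ := ⟨h1, h2, h3⟩
  rw [fourierInv_heatSymbol hn h hs0 ht, heatKernel_eq hn h hs0 ht]

lemma continuous_fourierInv {n : ℕ} {f : EuclideanSpace ℝ (Fin n) → ℂ} (hf : Integrable f) :
    Continuous (𝓕⁻ f) := by
  have e : 𝓕⁻ f = fun x => 𝓕 f (-x) := by
    ext x; exact Real.fourierInv_eq_fourier_neg f x
  rw [e]
  have : Continuous (𝓕 f) := VectorFourier.fourierIntegral_continuous Real.continuous_fourierChar
    (by exact continuous_inner) hf
  exact this.comp continuous_neg

lemma continuous_heatKernel {n : ℕ} (hn : 1 ≤ n) {s t : ℝ} (hs : 0 < s) (ht : 0 < t) :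
    Continuous (heatKernel s t : EuclideanSpace ℝ (Fin n) → ℝ) :=
  Complex.continuous_re.comp (continuous_fourierInv (integrable_heatSymbol hn hs ht).ofReal)

lemma abs_heatKernel_le {n : ℕ} {s t : ℝ} (x : EuclideanSpace ℝ (Fin n)) :
    |heatKernel s t x| ≤ ∫ ξ : EuclideanSpace ℝ (Fin n), heatSymbol s t ξ := by
  refine (Complex.abs_re_le_norm _).trans ?_
  rw [Real.fourierInv_eq]
  refine (norm_integral_le_integral_norm _).trans_eq ?_
  congr 1 with ξ
  rw [Circle.norm_smul, Complex.norm_real, Real.norm_of_nonneg (Real.exp_pos _).le]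
  rfl

lemma integrable_heatKernel_mul {n : ℕ} (hn : 1 ≤ n) {s t : ℝ} (hs : 0 < s) (ht : 0 < t)
    {u₀ : EuclideanSpace ℝ (Fin n) → ℝ} (hu : Integrable u₀) (x : EuclideanSpace ℝ (Fin n)) :
    Integrable fun y => heatKernel s t (x - y) * u₀ y := by
  refine hu.bdd_mul (c := ∫ ξ : EuclideanSpace ℝ (Fin n), heatSymbol s t ξ) ?_ ?_
  · exact ((continuous_heatKernel hn hs ht).comp (by fun_prop)).aestronglyMeasurable
  · exact ae_of_all _ fun y => abs_heatKernel_le _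

/-- Positivity of the fractional kernel, and the Lipschitz bound for its logarithm. -/
lemma heatKernel_pos_and_abs_sub_le {n : ℕ} (hn : 1 ≤ n) {s : ℝ} (hs0 : 0 < s) (hs1 : s < 1) :
    ∃ C : ℝ, 0 < C ∧ ∀ t : ℝ, 0 < t → ∀ x : EuclideanSpace ℝ (Fin n), 0 < heatKernel s t x ∧
      ∀ y : EuclideanSpace ℝ (Fin n), ‖y‖ ≤ t ^ (1 / (2 * s)) →
        |heatKernel s t (x - y) - heatKernel s t x|
          ≤ C * (‖y‖ * t ^ (-(1 / (2 * s)))) * heatKernel s t x := by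
  obtain ⟨μ, h1, h2, h3⟩ := exists_stable_law hs0 hs1
  have h : IsStableLaw s μ := ⟨h1, h2, h3⟩
  have hp : (0 : ℝ) < (n : ℝ) / 2 := by
    have : (0 : ℝ) < n := by exact_mod_cast hn
    positivity
  obtain ⟨C, hC, hle⟩ := h.exists_abs_gaussMix_sub_le hs0 hs1 hp
  refine ⟨C, hC, fun t ht x => ⟨?_, fun y hy => ?_⟩⟩
  · rw [heatKernel_eq hn h hs0 ht]
    exact mul_pos (by positivity) (h.gaussMix_pos hs0 hs1 hp (by positivity))
  · have hσ : 0 < t ^ (1 / (2 * s)) := by positivity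
    set σ := t ^ (1 / (2 * s)) with hσd
    -- The radial profile sees a translation by y only through the change of |x|, at most |y| by the
    -- triangle inequality.
    have hd : |‖x‖ / σ - ‖x - y‖ / σ| ≤ ‖y‖ / σ := by
      rw [← sub_div, abs_div, abs_of_pos hσ]
      gcongr
      simpa using abs_norm_sub_norm_le x (x - y)
    have hle1 := hle (‖x‖ / σ) (‖x - y‖ / σ) (by positivity) (by positivity)
      (hd.trans ((div_le_one hσ).2 hy))
    have hg := (h.gaussMix_pos hs0 hs1 hp (r := ‖x‖ / σ) (by positivity)).le
    rw [heatKernel_eq hn h hs0 ht, heatKernel_eq hn h hs0 ht, ← hσd, ← mul_sub, abs_mul,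
      abs_of_nonneg (by positivity), Real.rpow_neg ht.le, ← hσd, ← div_eq_mul_inv]
    calc _ ≤ (4 * Real.pi * t ^ (1 / s)) ^ (-((n : ℝ) / 2)) *
          (C * (‖y‖ / σ) * gaussMix μ ((n : ℝ) / 2) (‖x‖ / σ)) := by
            gcongr
            refine hle1.trans ?_
            gcongr
      _ = _ := by ring

/-- The representation formula has relative error `O (R t^{-1/2s})`. -/
lemma relError_heatSolution_le {n : ℕ} (hn : 1 ≤ n) {s : ℝ} (hs0 : 0 < s) (hs1 : s < 1) :
    ∃ C : ℝ, 0 < C ∧ ∀ R t : ℝ, 0 < R → 0 < t → R ≤ t ^ (1 / (2 * s)) →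
      ∀ u₀ : EuclideanSpace ℝ (Fin n) → ℝ, Integrable u₀ →
        (∀ᵐ y, y ∉ Metric.closedBall (0 : EuclideanSpace ℝ (Fin n)) R → u₀ y = 0) →
          (∀ x : EuclideanSpace ℝ (Fin n), 0 < heatKernel s t x) ∧
          (∀ x, relError s (∫ y, u₀ y) t (heatSolution s u₀ t) x
              ≤ C * (∫ y, |u₀ y|) * R * t ^ (-(1 / (2 * s)))) := by
  obtain ⟨C, hC, hle⟩ := heatKernel_pos_and_abs_sub_le hn hs0 hs1
  refine ⟨C, hC, fun R t hR ht hRt u₀ hu hsupp => ⟨fun x => (hle t ht x).1, fun x => ?_⟩⟩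
  obtain ⟨hpos, hx⟩ := hle t ht x
  rw [relError, div_le_iff₀ hpos, heatSolution, ← integral_mul_const,
    ← integral_sub (integrable_heatKernel_mul hn hs0 ht hu x) (hu.mul_const _), ← Real.norm_eq_abs]
  have hb : ∀ᵐ y, ‖heatKernel s t (x - y) * u₀ y - u₀ y * heatKernel s t x‖
      ≤ C * (R * t ^ (-(1 / (2 * s)))) * heatKernel s t x * |u₀ y| := by
    filter_upwards [hsupp] with y hy
    by_cases hyR : y ∈ Metric.closedBall (0 : EuclideanSpace ℝ (Fin n)) R
    · rw [mem_closedBall_zero_iff] at hyR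
      rw [mul_comm (u₀ y), ← sub_mul, norm_mul, Real.norm_eq_abs, Real.norm_eq_abs]
      refine mul_le_mul_of_nonneg_right ((hx y (hyR.trans hRt)).trans ?_) (abs_nonneg _)
      gcongr
    · rw [hy hyR]; simp
  refine (norm_integral_le_of_norm_le (hu.abs.const_mul _) hb).trans_eq ?_
  rw [integral_const_mul]
  ring

/-! ### The Gaussian case -/

lemma heatKernel_one_sub {n : ℕ} {t : ℝ} (ht : 0 < t) (x y : EuclideanSpace ℝ (Fin n)) :
    heatKernel 1 t (x - y)
      = Real.exp ((2 * inner ℝ x y - ‖y‖ ^ 2) / (4 * t)) * heatKernel 1 t x := by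
  rw [heatKernel_one ht, heatKernel_one ht, mul_left_comm, ← Real.exp_add, norm_sub_sq_real]
  congr 2
  field_simp
  ring

lemma heatKernel_one_pos {n : ℕ} {t : ℝ} (ht : 0 < t) (x : EuclideanSpace ℝ (Fin n)) :
    0 < heatKernel 1 t x := by
  rw [heatKernel_one ht]; positivity

lemma exists_lt_relError_translate {n : ℕ} {h : EuclideanSpace ℝ (Fin n)} (hh : h ≠ 0) {t : ℝ}
    (ht : 0 < t) (K : ℝ) : ∃ x, K < relError 1 1 t (fun z => heatKernel 1 t (z - h)) x := by
  have hn : 0 < ‖h‖ := norm_pos_iff.2 hh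
  -- Solves (2l - 1)|h|² = 4t(K + 1), so that the kernel ratio at lh is e^{K+1}.
  set l : ℝ := ((K + 1) * (4 * t) / ‖h‖ ^ 2 + 1) / 2 with hl
  refine ⟨l • h, ?_⟩
  have hp := heatKernel_one_pos ht (l • h)
  have e : (2 * inner ℝ (l • h) h - ‖h‖ ^ 2) / (4 * t) = K + 1 := by
    rw [real_inner_smul_left, real_inner_self_eq_norm_sq, hl]
    field_simp
    ring
  rw [relError, heatKernel_one_sub ht, e, ← sub_mul, abs_mul, abs_of_pos hp,
    mul_div_cancel_right₀ _ hp.ne']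
  have h1 := Real.add_one_le_exp (K + 1)
  have h2 := le_abs_self (Real.exp (K + 1) - 1)
  linarith

lemma integrable_exp_mul {n : ℕ} (hn : 1 ≤ n) {t : ℝ} (ht : 0 < t)
    {u₀ : EuclideanSpace ℝ (Fin n) → ℝ} (hu : Integrable u₀) (x : EuclideanSpace ℝ (Fin n)) :
    Integrable fun y => Real.exp ((2 * inner ℝ x y - ‖y‖ ^ 2) / (4 * t)) * u₀ y := by
  have hp := heatKernel_one_pos ht x
  refine ((integrable_heatKernel_mul hn one_pos ht hu x).const_mul (heatKernel 1 t x)⁻¹).congr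
    (ae_of_all _ fun y => ?_)
  simp only
  rw [heatKernel_one_sub ht]
  field_simp

/-- Along a ray x = le the ratio u/P_t is the integral of exp((l/2t) e·y - |y|²/4t) u₀(y), and e^a ≥
max(a, 0) bounds it below by (l/2t) ∫ w_e. A direction with ∫ w_e > 0 exists, since otherwise the
vectors ±eᵢ would force u₀ = 0 almost everywhere off the origin, against positive mass. -/
lemma exists_lt_relError_heatSolution_one {n : ℕ} (hn : 1 ≤ n)
    {u₀ : EuclideanSpace ℝ (Fin n) → ℝ} (hu : Integrable u₀) (hu0 : 0 ≤ᵐ[volume] u₀)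
    (hM : 0 < ∫ y, u₀ y) {t : ℝ} (ht : 0 < t) (K : ℝ) :
    ∃ x, K < relError 1 (∫ y, u₀ y) t (heatSolution 1 u₀ t) x := by
  have : Nonempty (Fin n) := ⟨⟨0, hn⟩⟩
  set w : EuclideanSpace ℝ (Fin n) → EuclideanSpace ℝ (Fin n) → ℝ := fun e y =>
    max (inner ℝ e y) 0 * Real.exp (-(‖y‖ ^ 2 / (4 * t))) * u₀ y with hw
  have hw0 : ∀ e, 0 ≤ᵐ[volume] w e := fun e => by
    filter_upwards [hu0] with y hy
    have : 0 ≤ u₀ y := hy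
    simp only [hw, Pi.zero_apply]; positivity
  have hwle : ∀ e (l : ℝ), 0 ≤ l → ∀ᵐ y, l / (2 * t) * w e y
      ≤ Real.exp ((2 * inner ℝ (l • e) y - ‖y‖ ^ 2) / (4 * t)) * u₀ y := fun e l hl => by
    filter_upwards [hu0] with y hy
    have hy' : 0 ≤ u₀ y := hy
    have e1 : Real.exp ((2 * inner ℝ (l • e) y - ‖y‖ ^ 2) / (4 * t))
        = Real.exp (l / (2 * t) * inner ℝ e y) * Real.exp (-(‖y‖ ^ 2 / (4 * t))) := by
      rw [← Real.exp_add, real_inner_smul_left]; congr 1; field_simp; ring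
    have e2 : l / (2 * t) * max (inner ℝ e y) 0 ≤ Real.exp (l / (2 * t) * inner ℝ e y) := by
      rw [mul_max_of_nonneg _ _ (by positivity), mul_zero]
      refine max_le ?_ (Real.exp_pos _).le
      have := Real.add_one_le_exp (l / (2 * t) * inner ℝ e y)
      linarith
    rw [e1]
    calc l / (2 * t) * w e y = l / (2 * t) * max (inner ℝ e y) 0
          * Real.exp (-(‖y‖ ^ 2 / (4 * t))) * u₀ y := by rw [hw]; ring
      _ ≤ _ := by gcongr
  have hwint : ∀ e, Integrable (w e) := fun e => by
    refine (integrable_exp_mul hn ht hu ((2 * t) • e)).mono' ?_ ?_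
    · exact AEStronglyMeasurable.mul
        (Continuous.aestronglyMeasurable (by fun_prop)) hu.aestronglyMeasurable
    · filter_upwards [hw0 e, hwle e (2 * t) (by positivity)] with y h1 h2
      rw [div_self (by positivity), one_mul] at h2
      rwa [Real.norm_of_nonneg h1]
  obtain ⟨e, he⟩ : ∃ e, 0 < ∫ y, w e y := by
    by_contra! hcon
    have hz : ∀ e, w e =ᵐ[volume] 0 := fun e =>
      (integral_eq_zero_iff_of_nonneg_ae (hw0 e) (hwint e)).1
        (le_antisymm (hcon e) (integral_nonneg_of_ae (hw0 e)))
    have hall : ∀ᵐ y, ∀ i : Fin n, w (EuclideanSpace.single i 1) y = 0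
        ∧ w (-EuclideanSpace.single i 1) y = 0 := by
      rw [ae_all_iff]
      intro i
      filter_upwards [hz (EuclideanSpace.single i 1), hz (-EuclideanSpace.single i 1)] with y h1 h2
      exact ⟨h1, h2⟩
    have hne : ∀ᵐ y : EuclideanSpace ℝ (Fin n), y ≠ 0 := by
      rw [ae_iff]; simp
    have hzero : u₀ =ᵐ[volume] 0 := by
      filter_upwards [hall, hne] with y hy hy0
      by_contra hne
      have hne : u₀ y ≠ 0 := hne
      refine hy0 ?_
      ext i
      obtain ⟨h1, h2⟩ := hy i
      simp only [hw, mul_eq_zero, hne, (Real.exp_pos _).ne', or_false, inner_neg_left,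
        EuclideanSpace.inner_single_left, map_one, one_mul, max_eq_right_iff] at h1 h2
      simp only [PiLp.zero_apply]
      linarith
    rw [integral_congr_ae hzero] at hM
    simp at hM
  set M := ∫ y, u₀ y with hMd
  set J := ∫ y, w e y with hJ
  -- Makes the lower bound (l/2t) J equal to |K| + M + 1, which exceeds M by more than K.
  set l : ℝ := (|K| + M + 1) * (2 * t) / J with hl
  have hl0 : 0 ≤ l := by positivity
  refine ⟨l • e, ?_⟩
  have hp := heatKernel_one_pos ht (l • e)
  have h1 : heatSolution 1 u₀ t (l • e)
      = (∫ y, Real.exp ((2 * inner ℝ (l • e) y - ‖y‖ ^ 2) / (4 * t)) * u₀ y)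
        * heatKernel 1 t (l • e) := by
    rw [heatSolution, ← integral_mul_const]
    congr 1 with y
    rw [heatKernel_one_sub ht]; ring
  have h2 : l / (2 * t) * J
      ≤ ∫ y, Real.exp ((2 * inner ℝ (l • e) y - ‖y‖ ^ 2) / (4 * t)) * u₀ y := by
    rw [hJ, ← integral_const_mul]
    exact integral_mono_ae ((hwint e).const_mul _) (integrable_exp_mul hn ht hu _) (hwle e l hl0)
  have h3 : l / (2 * t) * J = |K| + M + 1 := by rw [hl]; field_simp
  rw [relError, h1, ← sub_mul, abs_mul, abs_of_pos hp, mul_div_cancel_right₀ _ hp.ne']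
  refine lt_of_lt_of_le ?_ (le_abs_self _)
  have := le_abs_self K
  linarith

/-! ### Fourier transforms of integrable functions -/

lemma integral_fourier_mul_eq {n : ℕ} {f g : EuclideanSpace ℝ (Fin n) → ℂ} (hf : Integrable f)
    (hg : Integrable g) : ∫ ξ, 𝓕 f ξ * g ξ = ∫ x, f x * 𝓕 g x := by
  have h := VectorFourier.integral_fourierIntegral_smul_eq_flip
    (L := innerₗ (EuclideanSpace ℝ (Fin n))) Real.continuous_fourierChar continuous_inner hf hg
  simpa using! h

lemma integral_fourierInv_mul_eq {n : ℕ} {f g : EuclideanSpace ℝ (Fin n) → ℂ} (hf : Integrable f)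
    (hg : Integrable g) : ∫ ξ, 𝓕⁻ f ξ * g ξ = ∫ x, f x * 𝓕⁻ g x := by
  have h := integral_fourier_mul_eq hf (g := fun ξ => g (-ξ)) hg.comp_neg
  have e : 𝓕⁻ g = 𝓕 fun ξ => g (-ξ) := Real.fourierInv_eq_fourier_comp_neg g
  rw [e, ← h, ← integral_neg_eq_self]
  simp [Real.fourierInv_eq_fourier_neg]

/-- No continuity of U is assumed, hence inversion only almost everywhere. Both sides are paired
with smooth compactly supported g; the multiplication formula moves the transforms onto g, where
inversion holds in the Schwartz space. -/
lemma ae_eq_fourierInv_fourier {n : ℕ} {U : EuclideanSpace ℝ (Fin n) → ℂ} (hU : Integrable U)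
    (hU' : Integrable (𝓕 U)) : ∀ᵐ x, U x = 𝓕⁻ (𝓕 U) x := by
  refine ae_eq_of_integral_contDiff_smul_eq hU.locallyIntegrable
    (continuous_fourierInv hU').locallyIntegrable fun g hg hgc => ?_
  let G : SchwartzMap (EuclideanSpace ℝ (Fin n)) ℂ :=
    (hgc.comp_left (g := Complex.ofReal) Complex.ofReal_zero).toSchwartzMap
      (Complex.ofRealCLM.contDiff.comp hg)
  have hG : ∀ x, G x = (g x : ℂ) := fun x => rfl
  have e1 : ∫ x, g x • U x = ∫ x, 𝓕 U x * 𝓕⁻ (G : EuclideanSpace ℝ (Fin n) → ℂ) x := by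
    have h := integral_fourier_mul_eq hU (𝓕⁻ G).integrable
    rw [← SchwartzMap.fourierInv_coe, h]
    refine integral_congr_ae (ae_of_all _ fun x => ?_)
    have h2 : 𝓕 ((𝓕⁻ G : SchwartzMap _ ℂ) : EuclideanSpace ℝ (Fin n) → ℂ) x = G x := by
      rw [← SchwartzMap.fourier_coe, FourierTransform.fourier_fourierInv_eq]
    simp only [h2, hG, Complex.real_smul]
    ring
  have e2 : ∫ x, g x • 𝓕⁻ (𝓕 U) x
      = ∫ x, 𝓕 U x * 𝓕⁻ (G : EuclideanSpace ℝ (Fin n) → ℂ) x := by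
    rw [← integral_fourierInv_mul_eq hU' G.integrable]
    refine integral_congr_ae (ae_of_all _ fun x => ?_)
    simp only [hG, Complex.real_smul]
    ring
  rw [e1, e2]

lemma continuous_fourier {n : ℕ} {f : EuclideanSpace ℝ (Fin n) → ℂ} (hf : Integrable f) :
    Continuous (𝓕 f) := VectorFourier.fourierIntegral_continuous Real.continuous_fourierChar
    (by exact continuous_inner) hf

lemma norm_fourier_le {n : ℕ} (f : EuclideanSpace ℝ (Fin n) → ℂ) (ξ : EuclideanSpace ℝ (Fin n)) :
    ‖𝓕 f ξ‖ ≤ ∫ x, ‖f x‖ := by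
  rw [Real.fourier_eq]
  refine (norm_integral_le_integral_norm _).trans_eq ?_
  simp only [Circle.norm_smul]

lemma integrable_heatSymbol_mul_fourier {n : ℕ} (hn : 1 ≤ n) {s t : ℝ} (hs : 0 < s) (ht : 0 < t)
    {U : EuclideanSpace ℝ (Fin n) → ℂ} (hU : Integrable U) :
    Integrable fun ξ => ((heatSymbol s t ξ : ℝ) : ℂ) * 𝓕 U ξ :=
  (integrable_heatSymbol hn hs ht).ofReal.mul_bdd (c := ∫ x, ‖U x‖)
    (continuous_fourier hU).aestronglyMeasurable (ae_of_all _ (norm_fourier_le U))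

/-- The multiplication formula applied to u₀ and the modulated symbol e^{2πi x·ξ} exp(-t|2πξ|^{2s}),
whose transform at y is P_t(x - y). -/
lemma heatSolution_eq_fourierInv {n : ℕ} (hn : 1 ≤ n) {s t : ℝ} (hs0 : 0 < s) (hs1 : s < 1)
    (ht : 0 < t) {u₀ : EuclideanSpace ℝ (Fin n) → ℝ} (hu : Integrable u₀)
    (x : EuclideanSpace ℝ (Fin n)) :
    ((heatSolution s u₀ t x : ℝ) : ℂ)
      = 𝓕⁻ (fun ξ => ((heatSymbol s t ξ : ℝ) : ℂ) * 𝓕 (fun y => ((u₀ y : ℝ) : ℂ)) ξ) x := by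
  have hg : Integrable fun ξ : EuclideanSpace ℝ (Fin n) =>
      (𝐞 (inner ℝ ξ x) : ℂ) * ((heatSymbol s t ξ : ℝ) : ℂ) :=
    (integrable_heatSymbol hn hs0 ht).ofReal.bdd_mul (c := 1)
      (Continuous.aestronglyMeasurable (by fun_prop)) (ae_of_all _ fun ξ => (Circle.norm_coe _).le)
  have h := integral_fourier_mul_eq (f := fun y => ((u₀ y : ℝ) : ℂ)) hu.ofReal hg
  rw [Real.fourierInv_eq]
  have e1 : ∀ ξ : EuclideanSpace ℝ (Fin n), 𝐞 (inner ℝ ξ x) • (((heatSymbol s t ξ : ℝ) : ℂ)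
      * 𝓕 (fun y => ((u₀ y : ℝ) : ℂ)) ξ) = 𝓕 (fun y => ((u₀ y : ℝ) : ℂ)) ξ *
        ((𝐞 (inner ℝ ξ x) : ℂ) * ((heatSymbol s t ξ : ℝ) : ℂ)) := fun ξ => by
    rw [Circle.smul_def, smul_eq_mul]; ring
  simp_rw [e1]
  rw [h, heatSolution, ← integral_complex_ofReal]
  congr 1 with y
  push_cast
  rw [mul_comm, ← fourierInv_heatSymbol_eq_heatKernel hn hs0 hs1 ht, Real.fourierInv_eq,
    Real.fourier_eq]
  congr 2 with ξ
  rw [Circle.smul_def, Circle.smul_def, smul_eq_mul, smul_eq_mul, ← mul_assoc, ← Circle.coe_mul,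
    ← AddChar.map_add_eq_mul, inner_sub_right]
  ring_nf

/-! ### Plane waves with a cutoff as test functions -/

/-- The symbol `|2πξ|^{2s}` of the fractional Laplacian. -/
noncomputable def fracSymbol {n : ℕ} (s : ℝ) (ξ : EuclideanSpace ℝ (Fin n)) : ℝ :=
  (2 * Real.pi * ‖ξ‖) ^ (2 * s)

lemma fracSymbol_nonneg {n : ℕ} (s : ℝ) (ξ : EuclideanSpace ℝ (Fin n)) : 0 ≤ fracSymbol s ξ := by
  unfold fracSymbol; positivity

lemma continuous_fracSymbol {n : ℕ} {s : ℝ} (hs : 0 < s) :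
    Continuous (fracSymbol s : EuclideanSpace ℝ (Fin n) → ℝ) :=
  (by fun_prop : Continuous fun ξ : EuclideanSpace ℝ (Fin n) => 2 * Real.pi * ‖ξ‖).rpow_const
    fun _ => Or.inr (by positivity)

lemma fracSymbol_add_smul_le {n : ℕ} {s ε : ℝ} (hs : 0 < s) (hε0 : 0 ≤ ε) (hε1 : ε ≤ 1)
    (ξ ζ : EuclideanSpace ℝ (Fin n)) :
    fracSymbol s (ξ + ε • ζ) ≤ (2 * Real.pi * (‖ξ‖ + ‖ζ‖)) ^ (2 * s) := by
  unfold fracSymbol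
  gcongr
  refine (norm_add_le _ _).trans ?_
  rw [norm_smul, Real.norm_of_nonneg hε0]
  have := mul_le_of_le_one_left (norm_nonneg ζ) hε1
  linarith

/-- Since 2s ≤ 2, the weight is dominated by 1 plus its square. The shift a allows the symbol near a
frequency of norm a to be dominated uniformly in the cutoff scale. -/
lemma integrable_rpow_mul_norm_schwartz {n : ℕ} {s a : ℝ} (hs0 : 0 < s) (hs1 : s < 1) (ha : 0 ≤ a)
    (G : SchwartzMap (EuclideanSpace ℝ (Fin n)) ℂ) :
    Integrable fun ζ => (2 * Real.pi * (a + ‖ζ‖)) ^ (2 * s) * ‖G ζ‖ := by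
  have i0 := (G.integrable (μ := volume)).norm
  have i2 := G.integrable_pow_mul volume 2
  have hb := ((i0.const_mul (1 + 2 * (2 * Real.pi * a) ^ 2))).add
    (i2.const_mul (2 * (2 * Real.pi) ^ 2))
  refine hb.mono' ?_ (ae_of_all _ fun ζ => ?_)
  · refine Continuous.aestronglyMeasurable (Continuous.mul ?_ G.continuous.norm)
    exact Continuous.rpow_const (by fun_prop) fun _ => Or.inr (by positivity)
  · have hz : 0 ≤ 2 * Real.pi * (a + ‖ζ‖) := by positivity
    rw [Real.norm_of_nonneg (by positivity)]
    have h1 : (2 * Real.pi * (a + ‖ζ‖)) ^ (2 * s) ≤ 1 + (2 * Real.pi * (a + ‖ζ‖)) ^ 2 := by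
      rcases le_total (2 * Real.pi * (a + ‖ζ‖)) 1 with h | h
      · exact (Real.rpow_le_one hz h (by positivity)).trans (by linarith [sq_nonneg (2 * Real.pi * (a + ‖ζ‖))])
      · have := Real.rpow_le_rpow_of_exponent_le h (show 2 * s ≤ 2 by linarith)
        rw [Real.rpow_two] at this
        linarith
    have h2 : (2 * Real.pi * (a + ‖ζ‖)) ^ 2
        ≤ 2 * (2 * Real.pi * a) ^ 2 + 2 * (2 * Real.pi) ^ 2 * ‖ζ‖ ^ 2 := by
      nlinarith [sq_nonneg (2 * Real.pi * a - 2 * Real.pi * ‖ζ‖)]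
    calc _ ≤ (1 + (2 * (2 * Real.pi * a) ^ 2 + 2 * (2 * Real.pi) ^ 2 * ‖ζ‖ ^ 2)) * ‖G ζ‖ := by
          gcongr; linarith
      _ = _ := by simp only [Pi.add_apply]; ring

/-- A smooth cutoff function. -/
noncomputable def cutoff (n : ℕ) : ContDiffBump (0 : EuclideanSpace ℝ (Fin n)) :=
  ⟨1, 2, one_pos, one_lt_two⟩

/-- The plane wave of frequency `ξ`, cut off at scale `ε⁻¹`. -/
noncomputable def cutWave {n : ℕ} (ε : ℝ) (ξ x : EuclideanSpace ℝ (Fin n)) : ℂ :=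
  ((cutoff n (ε • x) : ℝ) : ℂ) * (𝐞 (inner ℝ x ξ) : ℂ)

lemma norm_cutWave_le {n : ℕ} (ε : ℝ) (ξ x : EuclideanSpace ℝ (Fin n)) : ‖cutWave ε ξ x‖ ≤ 1 := by
  rw [cutWave, norm_mul, Circle.norm_coe, mul_one, Complex.norm_real,
    Real.norm_of_nonneg (cutoff n).nonneg]
  exact (cutoff n).le_one

lemma contDiff_fourierChar_inner {n : ℕ} (ξ : EuclideanSpace ℝ (Fin n)) :
    ContDiff ℝ (⊤ : ℕ∞) fun x : EuclideanSpace ℝ (Fin n) => (𝐞 (inner ℝ x ξ) : ℂ) := by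
  simp_rw [Real.fourierChar_apply]
  refine ContDiff.cexp (ContDiff.mul ?_ contDiff_const)
  have h : ContDiff ℝ (⊤ : ℕ∞) fun x : EuclideanSpace ℝ (Fin n) =>
      2 * Real.pi * (inner ℝ x ξ : ℝ) := contDiff_const.mul (contDiff_id.inner ℝ contDiff_const)
  exact Complex.ofRealCLM.contDiff.comp h

lemma contDiff_cutWave {n : ℕ} (ε : ℝ) (ξ : EuclideanSpace ℝ (Fin n)) :
    ContDiff ℝ (⊤ : ℕ∞) (cutWave ε ξ) := by
  refine ContDiff.mul ?_ (contDiff_fourierChar_inner ξ)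
  exact Complex.ofRealCLM.contDiff.comp ((cutoff n).contDiff.comp (by fun_prop))

lemma hasCompactSupport_cutWave {n : ℕ} {ε : ℝ} (hε : ε ≠ 0) (ξ : EuclideanSpace ℝ (Fin n)) :
    HasCompactSupport (cutWave ε ξ) := by
  have h1 : HasCompactSupport fun x : EuclideanSpace ℝ (Fin n) => cutoff n (ε • x) :=
    (cutoff n).hasCompactSupport.comp_homeomorph (Homeomorph.smulOfNeZero ε hε)
  exact (h1.comp_left (g := Complex.ofReal) Complex.ofReal_zero).mul_right

/-- The cutoff function as a complex Schwartz function. -/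
noncomputable def cutoffSchwartz (n : ℕ) : SchwartzMap (EuclideanSpace ℝ (Fin n)) ℂ :=
  ((cutoff n).hasCompactSupport.comp_left (g := Complex.ofReal) Complex.ofReal_zero).toSchwartzMap
      (Complex.ofRealCLM.contDiff.comp (cutoff n).contDiff)

lemma cutoffSchwartz_apply {n : ℕ} (x : EuclideanSpace ℝ (Fin n)) :
    cutoffSchwartz n x = ((cutoff n x : ℝ) : ℂ) := rfl

/-- `(-Δ)^s` on complex functions, through the Fourier transform. -/
noncomputable def fracLaplacianC {n : ℕ} (s : ℝ) (ψ : EuclideanSpace ℝ (Fin n) → ℂ) :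
    EuclideanSpace ℝ (Fin n) → ℂ :=
  𝓕⁻ fun ξ => ((fracSymbol s ξ : ℝ) : ℂ) * 𝓕 ψ ξ

lemma integrable_fracSymbol_mul_fourier_cutWave {n : ℕ} {s ε : ℝ} (hs0 : 0 < s) (hs1 : s < 1)
    (hε : ε ≠ 0) (ξ : EuclideanSpace ℝ (Fin n)) :
    Integrable fun η => ((fracSymbol s η : ℝ) : ℂ) * 𝓕 (cutWave ε ξ) η := by
  let G : SchwartzMap (EuclideanSpace ℝ (Fin n)) ℂ :=
    (hasCompactSupport_cutWave hε ξ).toSchwartzMap (contDiff_cutWave ε ξ)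
  have hG : ((𝓕 G : SchwartzMap _ ℂ) : EuclideanSpace ℝ (Fin n) → ℂ) = 𝓕 (cutWave ε ξ) := SchwartzMap.fourier_coe G
  have h := integrable_rpow_mul_norm_schwartz hs0 hs1 le_rfl (𝓕 G)
  rw [← hG]
  refine h.mono' ?_ (ae_of_all _ fun η => ?_)
  · exact (Complex.continuous_ofReal.comp (continuous_fracSymbol hs0)).mul (𝓕 G).continuous
      |>.aestronglyMeasurable
  · rw [norm_mul, Complex.norm_real, Real.norm_of_nonneg (fracSymbol_nonneg _ _), fracSymbol,
      zero_add]

lemma fourier_cutWave {n : ℕ} {ε : ℝ} (hε : 0 < ε) (ξ ζ : EuclideanSpace ℝ (Fin n)) :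
    𝓕 (cutWave ε ξ) (ξ + ε • ζ) = (((ε ^ n)⁻¹ : ℝ) : ℂ) * 𝓕 (cutoffSchwartz n) ζ := by
  rw [SchwartzMap.fourier_coe, Real.fourier_eq, Real.fourier_eq]
  have h := Measure.integral_comp_smul_of_nonneg (volume : Measure (EuclideanSpace ℝ (Fin n)))
    (fun v => 𝐞 (-inner ℝ v ζ) • cutoffSchwartz n v) ε (hR := hε.le)
  rw [finrank_euclideanSpace, Fintype.card_fin, Complex.real_smul] at h
  rw [← h]
  congr 1 with v
  rw [cutWave, cutoffSchwartz_apply, Circle.smul_def, Circle.smul_def, smul_eq_mul, smul_eq_mul,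
    mul_left_comm, ← Circle.coe_mul, ← AddChar.map_add_eq_mul, mul_comm]
  congr 3
  rw [inner_add_right, real_inner_smul_left, real_inner_smul_right]
  ring

/-- The transform of the cut-off wave concentrates at ξ on the scale ε, so η = ξ + εζ is the natural
variable. In it the integrand depends on ε only through the symbol and the character, which are
continuous at ε = 0. -/
lemma fracLaplacianC_cutWave {n : ℕ} {s ε : ℝ} (hε : 0 < ε) (ξ x : EuclideanSpace ℝ (Fin n)) :
    fracLaplacianC s (cutWave ε ξ) x = ∫ ζ, (𝐞 (inner ℝ (ξ + ε • ζ) x) : ℂ)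
      * (((fracSymbol s (ξ + ε • ζ) : ℝ) : ℂ) * 𝓕 (cutoffSchwartz n) ζ) := by
  rw [fracLaplacianC, Real.fourierInv_eq]
  rw [← integral_add_left_eq_self _ ξ]
  have h := Measure.integral_comp_smul_of_nonneg (volume : Measure (EuclideanSpace ℝ (Fin n)))
    (fun η => 𝐞 (inner ℝ (ξ + η) x) •
      (((fracSymbol s (ξ + η) : ℝ) : ℂ) * 𝓕 (cutWave ε ξ) (ξ + η))) ε (hR := hε.le)
  rw [finrank_euclideanSpace, Fintype.card_fin, Complex.real_smul] at h
  have hne : (((ε ^ n)⁻¹ : ℝ) : ℂ) ≠ 0 := by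
    rw [Complex.ofReal_ne_zero]; positivity
  -- Both the change of variables and the transform of the dilated cutoff produce ε^{-n}; the two
  -- factors cancel.
  refine mul_left_cancel₀ hne ?_
  rw [← h, ← integral_const_mul]
  congr 1 with ζ
  rw [fourier_cutWave hε, Circle.smul_def, smul_eq_mul]
  ring

lemma norm_fracLaplacianC_cutWave_le {n : ℕ} {s ε : ℝ} (hs0 : 0 < s) (hs1 : s < 1) (hε0 : 0 < ε)
    (hε1 : ε ≤ 1) (ξ x : EuclideanSpace ℝ (Fin n)) :
    ‖fracLaplacianC s (cutWave ε ξ) x‖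
      ≤ ∫ ζ, (2 * Real.pi * (‖ξ‖ + ‖ζ‖)) ^ (2 * s) * ‖𝓕 (cutoffSchwartz n) ζ‖ := by
  rw [fracLaplacianC_cutWave hε0]
  refine norm_integral_le_of_norm_le
    (integrable_rpow_mul_norm_schwartz hs0 hs1 (norm_nonneg _) _) (ae_of_all _ fun ζ => ?_)
  rw [norm_mul, Circle.norm_coe, one_mul, norm_mul, Complex.norm_real,
    Real.norm_of_nonneg (fracSymbol_nonneg _ _)]
  gcongr
  exact fracSymbol_add_smul_le hs0 hε0.le hε1 _ _

lemma integral_fourier_cutoffSchwartz (n : ℕ) :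
    ∫ ζ, 𝓕 (cutoffSchwartz n) ζ = 1 := by
  have h : 𝓕⁻ (𝓕 (cutoffSchwartz n)) 0 = cutoffSchwartz n 0 := by
    rw [FourierTransform.fourierInv_fourier_eq]
  rw [SchwartzMap.fourierInv_coe, Real.fourierInv_eq] at h
  have h1 : cutoff n 0 = 1 := (cutoff n).one_of_mem_closedBall (by simp [(cutoff n).rIn_pos.le])
  simpa [cutoffSchwartz_apply, h1] using h

/-- As ε → 0 the symbol freezes at ξ, and the transform of the cutoff has integral cutoff(0) = 1:
plane waves are eigenfunctions of (-Δ)^s. -/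
lemma tendsto_fracLaplacianC_cutWave {n : ℕ} {s : ℝ} (hs0 : 0 < s) (hs1 : s < 1)
    {ε : ℕ → ℝ} (hε0 : ∀ k, 0 < ε k) (hε1 : ∀ k, ε k ≤ 1) (hε : Tendsto ε atTop (𝓝 0))
    (ξ x : EuclideanSpace ℝ (Fin n)) :
    Tendsto (fun k => fracLaplacianC s (cutWave (ε k) ξ) x) atTop
      (𝓝 (((fracSymbol s ξ : ℝ) : ℂ) * (𝐞 (inner ℝ x ξ) : ℂ))) := by
  simp_rw [fun k => fracLaplacianC_cutWave (s := s) (hε0 k) ξ x]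
  have hlim : ((fracSymbol s ξ : ℝ) : ℂ) * (𝐞 (inner ℝ x ξ) : ℂ)
      = ∫ ζ, (𝐞 (inner ℝ ξ x) : ℂ) * (((fracSymbol s ξ : ℝ) : ℂ) * 𝓕 (cutoffSchwartz n) ζ) := by
    rw [integral_const_mul, integral_const_mul, integral_fourier_cutoffSchwartz, real_inner_comm]
    ring
  rw [hlim]
  have hcs : Continuous fun p : ℝ × EuclideanSpace ℝ (Fin n) =>
      (𝐞 (inner ℝ (ξ + p.1 • p.2) x) : ℂ)
      * (((fracSymbol s (ξ + p.1 • p.2) : ℝ) : ℂ) * 𝓕 (cutoffSchwartz n) p.2) := by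
    refine Continuous.mul (by fun_prop) (Continuous.mul ?_ ?_)
    · exact Complex.continuous_ofReal.comp ((continuous_fracSymbol hs0).comp (by fun_prop))
    · exact (𝓕 (cutoffSchwartz n)).continuous.comp continuous_snd
  refine tendsto_integral_of_dominated_convergence
    (fun ζ => (2 * Real.pi * (‖ξ‖ + ‖ζ‖)) ^ (2 * s) * ‖𝓕 (cutoffSchwartz n) ζ‖) (fun k => ?_)
    (integrable_rpow_mul_norm_schwartz hs0 hs1 (norm_nonneg _) _) (fun k => ae_of_all _ fun ζ => ?_)
    (ae_of_all _ fun ζ => ?_)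
  · exact (hcs.comp (by fun_prop : Continuous fun ζ : EuclideanSpace ℝ (Fin n) =>
      (ε k, ζ))).aestronglyMeasurable
  · rw [norm_mul, Circle.norm_coe, one_mul, norm_mul, Complex.norm_real,
      Real.norm_of_nonneg (fracSymbol_nonneg _ _)]
    gcongr
    exact fracSymbol_add_smul_le hs0 (hε0 k).le (hε1 k) _ _
  · have h := (hcs.comp (by fun_prop : Continuous fun e : ℝ => (e, ζ))).tendsto 0
    have h2 := h.comp hε
    simp only [Function.comp_apply, zero_smul, add_zero] at h2
    exact h2

/-! ### Uniqueness of weak solutions -/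

/-- The real part of `w` times the cut-off plane wave: a real test function. -/
noncomputable def testWave {n : ℕ} (w : ℂ) (ε : ℝ) (ξ x : EuclideanSpace ℝ (Fin n)) : ℝ :=
  (w * cutWave ε ξ x).re

lemma conj_cutWave {n : ℕ} (ε : ℝ) (ξ x : EuclideanSpace ℝ (Fin n)) :
    (starRingEnd ℂ) (cutWave ε ξ x) = cutWave ε (-ξ) x := by
  rw [cutWave, cutWave, map_mul, Complex.conj_ofReal, inner_neg_right, AddChar.map_neg_eq_inv,
    Circle.coe_inv_eq_conj]

lemma ofReal_testWave {n : ℕ} (w : ℂ) (ε : ℝ) (ξ x : EuclideanSpace ℝ (Fin n)) :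
    ((testWave w ε ξ x : ℝ) : ℂ)
      = w / 2 * cutWave ε ξ x + (starRingEnd ℂ) w / 2 * cutWave ε (-ξ) x := by
  rw [testWave, Complex.re_eq_add_conj, map_mul, conj_cutWave]
  ring

lemma contDiff_testWave {n : ℕ} (w : ℂ) (ε : ℝ) (ξ : EuclideanSpace ℝ (Fin n)) :
    ContDiff ℝ (⊤ : ℕ∞) (testWave w ε ξ) :=
  Complex.reCLM.contDiff.comp (contDiff_const.mul (contDiff_cutWave ε ξ))

lemma hasCompactSupport_testWave {n : ℕ} (w : ℂ) {ε : ℝ} (hε : ε ≠ 0)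
    (ξ : EuclideanSpace ℝ (Fin n)) : HasCompactSupport (testWave w ε ξ) :=
  (hasCompactSupport_cutWave hε ξ).comp_left (g := fun z => (w * z).re) (by simp)

lemma integrable_cutWave {n : ℕ} {ε : ℝ} (hε : ε ≠ 0) (ξ : EuclideanSpace ℝ (Fin n)) :
    Integrable (cutWave ε ξ) :=
  (contDiff_cutWave ε ξ).continuous.integrable_of_hasCompactSupport (hasCompactSupport_cutWave hε ξ)

lemma fourier_combination {n : ℕ} {f g : EuclideanSpace ℝ (Fin n) → ℂ} (hf : Integrable f)
    (hg : Integrable g) (a b : ℂ) (ξ : EuclideanSpace ℝ (Fin n)) :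
    𝓕 (fun x => a * f x + b * g x) ξ = a * 𝓕 f ξ + b * 𝓕 g ξ := by
  have hf' := ((Real.fourierIntegral_convergent_iff ξ).2 hf).const_mul a
  have hg' := ((Real.fourierIntegral_convergent_iff ξ).2 hg).const_mul b
  rw [Real.fourier_eq, Real.fourier_eq, Real.fourier_eq, ← integral_const_mul,
    ← integral_const_mul, ← integral_add hf' hg']
  congr 1 with x
  simp only [Circle.smul_def, smul_eq_mul]
  ring

lemma fourierInv_combination {n : ℕ} {f g : EuclideanSpace ℝ (Fin n) → ℂ} (hf : Integrable f)
    (hg : Integrable g) (a b : ℂ) (ξ : EuclideanSpace ℝ (Fin n)) :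
    𝓕⁻ (fun x => a * f x + b * g x) ξ = a * 𝓕⁻ f ξ + b * 𝓕⁻ g ξ := by
  simp only [Real.fourierInv_eq_fourier_neg]
  exact fourier_combination hf hg a b (-ξ)

lemma fracLaplacian_testWave {n : ℕ} {s ε : ℝ} (hs0 : 0 < s) (hs1 : s < 1) (hε : ε ≠ 0) (w : ℂ)
    (ξ x : EuclideanSpace ℝ (Fin n)) :
    fracLaplacian s (testWave w ε ξ) x = (w / 2 * fracLaplacianC s (cutWave ε ξ) x
      + (starRingEnd ℂ) w / 2 * fracLaplacianC s (cutWave ε (-ξ)) x).re := by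
  have e1 : (fun y : EuclideanSpace ℝ (Fin n) => ((testWave w ε ξ y : ℝ) : ℂ))
      = fun y => w / 2 * cutWave ε ξ y + (starRingEnd ℂ) w / 2 * cutWave ε (-ξ) y := by
    ext y; exact ofReal_testWave w ε ξ y
  have e2 : (fun η : EuclideanSpace ℝ (Fin n) => (((2 * Real.pi * ‖η‖) ^ (2 * s) : ℝ) : ℂ) *
      𝓕 (fun y : EuclideanSpace ℝ (Fin n) => ((testWave w ε ξ y : ℝ) : ℂ)) η)
      = fun η => w / 2 * (((fracSymbol s η : ℝ) : ℂ) * 𝓕 (cutWave ε ξ) η)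
        + (starRingEnd ℂ) w / 2 * (((fracSymbol s η : ℝ) : ℂ) * 𝓕 (cutWave ε (-ξ)) η) := by
    ext η
    rw [e1, fourier_combination (integrable_cutWave hε ξ) (integrable_cutWave hε (-ξ)), fracSymbol]
    ring
  rw [fracLaplacian, e2, fourierInv_combination
    (integrable_fracSymbol_mul_fourier_cutWave hs0 hs1 hε ξ)
    (integrable_fracSymbol_mul_fourier_cutWave hs0 hs1 hε (-ξ))]
  rfl

lemma continuous_fracLaplacian_testWave {n : ℕ} {s ε : ℝ} (hs0 : 0 < s) (hs1 : s < 1) (hε : ε ≠ 0)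
    (w : ℂ) (ξ : EuclideanSpace ℝ (Fin n)) : Continuous (fracLaplacian s (testWave w ε ξ)) := by
  have e : fracLaplacian s (testWave w ε ξ) = fun x => (w / 2 * fracLaplacianC s (cutWave ε ξ) x
      + (starRingEnd ℂ) w / 2 * fracLaplacianC s (cutWave ε (-ξ)) x).re := by
    ext x; exact fracLaplacian_testWave hs0 hs1 hε w ξ x
  rw [e]
  have h1 : Continuous (fracLaplacianC s (cutWave ε ξ)) :=
    continuous_fourierInv (integrable_fracSymbol_mul_fourier_cutWave hs0 hs1 hε ξ)
  have h2 : Continuous (fracLaplacianC s (cutWave ε (-ξ))) :=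
    continuous_fourierInv (integrable_fracSymbol_mul_fourier_cutWave hs0 hs1 hε (-ξ))
  exact Complex.continuous_re.comp (by fun_prop)

/-- The real part of `w` times a plane wave. -/
noncomputable def planeWave {n : ℕ} (w : ℂ) (ξ x : EuclideanSpace ℝ (Fin n)) : ℝ :=
  (w * (𝐞 (inner ℝ x ξ) : ℂ)).re

lemma continuous_planeWave {n : ℕ} (w : ℂ) (ξ : EuclideanSpace ℝ (Fin n)) :
    Continuous (planeWave w ξ) := Complex.continuous_re.comp (by fun_prop)

lemma abs_planeWave_le {n : ℕ} (w : ℂ) (ξ x : EuclideanSpace ℝ (Fin n)) :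
    |planeWave w ξ x| ≤ ‖w‖ := by
  refine (Complex.abs_re_le_norm _).trans_eq ?_
  rw [norm_mul, Circle.norm_coe, mul_one]

lemma abs_testWave_le {n : ℕ} (w : ℂ) (ε : ℝ) (ξ x : EuclideanSpace ℝ (Fin n)) :
    |testWave w ε ξ x| ≤ ‖w‖ := by
  refine (Complex.abs_re_le_norm _).trans ?_
  rw [norm_mul]
  exact mul_le_of_le_one_right (norm_nonneg _) (norm_cutWave_le _ _ _)

lemma exists_abs_fracLaplacian_testWave_le {n : ℕ} {s : ℝ} (hs0 : 0 < s) (hs1 : s < 1) (w : ℂ)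
    (ξ : EuclideanSpace ℝ (Fin n)) :
    ∃ B : ℝ, ∀ ε : ℝ, 0 < ε → ε ≤ 1 → ∀ x, |fracLaplacian s (testWave w ε ξ) x| ≤ B := by
  refine ⟨‖w / 2‖ * (∫ ζ, (2 * Real.pi * (‖ξ‖ + ‖ζ‖)) ^ (2 * s) * ‖𝓕 (cutoffSchwartz n) ζ‖)
    + ‖(starRingEnd ℂ) w / 2‖ *
      (∫ ζ, (2 * Real.pi * (‖-ξ‖ + ‖ζ‖)) ^ (2 * s) * ‖𝓕 (cutoffSchwartz n) ζ‖),
    fun ε hε0 hε1 x => ?_⟩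
  rw [fracLaplacian_testWave hs0 hs1 hε0.ne']
  refine (Complex.abs_re_le_norm _).trans ((norm_add_le _ _).trans ?_)
  rw [norm_mul, norm_mul]
  gcongr
  · exact norm_fracLaplacianC_cutWave_le hs0 hs1 hε0 hε1 ξ x
  · exact norm_fracLaplacianC_cutWave_le hs0 hs1 hε0 hε1 (-ξ) x

lemma tendsto_testWave {n : ℕ} (w : ℂ) {ε : ℕ → ℝ} (hε : Tendsto ε atTop (𝓝 0))
    (ξ x : EuclideanSpace ℝ (Fin n)) :
    Tendsto (fun k => testWave w (ε k) ξ x) atTop (𝓝 (planeWave w ξ x)) := by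
  have hc : Continuous fun e : ℝ => testWave w e ξ x := by
    refine Complex.continuous_re.comp (continuous_const.mul (Continuous.mul ?_ continuous_const))
    exact Complex.continuous_ofReal.comp ((cutoff n).continuous.comp (by fun_prop))
  have h := (hc.tendsto 0).comp hε
  have h1 : cutoff n 0 = 1 := (cutoff n).one_of_mem_closedBall (by simp [(cutoff n).rIn_pos.le])
  have e : testWave w 0 ξ x = planeWave w ξ x := by
    rw [testWave, cutWave, zero_smul, h1, Complex.ofReal_one, one_mul, planeWave]
  rw [e] at h
  exact h

lemma tendsto_fracLaplacian_testWave {n : ℕ} {s : ℝ} (hs0 : 0 < s) (hs1 : s < 1) (w : ℂ)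
    {ε : ℕ → ℝ} (hε0 : ∀ k, 0 < ε k) (hε1 : ∀ k, ε k ≤ 1) (hε : Tendsto ε atTop (𝓝 0))
    (ξ x : EuclideanSpace ℝ (Fin n)) :
    Tendsto (fun k => fracLaplacian s (testWave w (ε k) ξ) x) atTop
      (𝓝 (fracSymbol s ξ * planeWave w ξ x)) := by
  simp_rw [fun k => fracLaplacian_testWave hs0 hs1 (hε0 k).ne' w ξ x]
  have h1 := (tendsto_fracLaplacianC_cutWave hs0 hs1 hε0 hε1 hε ξ x).const_mul (w / 2)
  have h2 := (tendsto_fracLaplacianC_cutWave hs0 hs1 hε0 hε1 hε (-ξ) x).const_mul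
    ((starRingEnd ℂ) w / 2)
  have h3 := (Complex.continuous_re.tendsto _).comp (h1.add h2)
  have e : (w / 2 * (((fracSymbol s ξ : ℝ) : ℂ) * (𝐞 (inner ℝ x ξ) : ℂ)) + (starRingEnd ℂ) w / 2 *
      (((fracSymbol s (-ξ) : ℝ) : ℂ) * (𝐞 (inner ℝ x (-ξ)) : ℂ))).re
      = fracSymbol s ξ * planeWave w ξ x := by
    have e1 : fracSymbol s (-ξ) = fracSymbol s ξ := by simp [fracSymbol]
    rw [e1, inner_neg_right, AddChar.map_neg_eq_inv, Circle.coe_inv_eq_conj, ← Complex.ofReal_re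
      (fracSymbol s ξ * planeWave w ξ x), Complex.ofReal_mul, planeWave, Complex.re_eq_add_conj,
      map_mul]
    congr 1
    ring
  rw [e] at h3
  exact h3

lemma tendsto_integral_mul_of_bounded {n : ℕ} {v : EuclideanSpace ℝ (Fin n) → ℝ}
    (hv : Integrable v) {g : ℕ → EuclideanSpace ℝ (Fin n) → ℝ} {g' : EuclideanSpace ℝ (Fin n) → ℝ}
    {B : ℝ} (hg : ∀ k, Continuous (g k)) (hB : ∀ k x, |g k x| ≤ B)
    (hlim : ∀ x, Tendsto (fun k => g k x) atTop (𝓝 (g' x))) :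
    Tendsto (fun k => ∫ x, v x * g k x) atTop (𝓝 (∫ x, v x * g' x)) := by
  refine tendsto_integral_of_dominated_convergence (fun x => |v x| * B)
    (fun k => hv.aestronglyMeasurable.mul (hg k).aestronglyMeasurable) (hv.abs.mul_const _)
    (fun k => ae_of_all _ fun x => ?_) (ae_of_all _ fun x => (hlim x).const_mul _)
  rw [norm_mul, Real.norm_eq_abs, Real.norm_eq_abs]
  exact mul_le_mul_of_nonneg_left (hB k x) (abs_nonneg _)

/-- Solutions of `y' = -a y` in integrated form. -/
lemma eq_mul_exp_of_integral_eq {y : ℝ → ℝ} {a c : ℝ} (hy : ContinuousOn y (Set.Ici 0))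
    (h : ∀ t, 0 ≤ t → y t = c - ∫ τ in (0 : ℝ)..t, a * y τ) {t : ℝ} (ht : 0 ≤ t) :
    y t = c * Real.exp (-(t * a)) := by
  -- Extending y by a constant to negative times gives a function continuous on the whole line, so
  -- its primitive is differentiable everywhere, including at 0; then e^{ta}(c - az) has zero
  -- derivative on [0,t].
  set Y : ℝ → ℝ := fun τ => y (max τ 0) with hY
  have hYc : Continuous Y := by
    have : Continuous fun τ : ℝ => (⟨max τ 0, Set.mem_Ici.2 (le_max_right _ _)⟩ : Set.Ici (0 : ℝ)) := by
      fun_prop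
    exact (continuousOn_iff_continuous_domRestrict.1 hy).comp this
  set z : ℝ → ℝ := fun t => ∫ τ in (0 : ℝ)..t, Y τ with hz
  have hzd : ∀ t, HasDerivAt z (Y t) t := fun t =>
    intervalIntegral.integral_hasDerivAt_right (hYc.intervalIntegrable _ _)
      (hYc.stronglyMeasurableAtFilter _ _) hYc.continuousAt
  have hyz : ∀ t, 0 ≤ t → Y t = c - a * z t := by
    intro t ht
    simp only [hY, max_eq_left ht, hz]
    rw [h t ht, intervalIntegral.integral_const_mul]
    congr 2
    refine intervalIntegral.integral_congr fun τ hτ => ?_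
    rw [Set.uIcc_of_le ht] at hτ
    simp only [max_eq_left hτ.1]
  have hwd : ∀ t, HasDerivAt (fun t => Real.exp (t * a) * (c - a * z t))
      (Real.exp (t * a) * (1 * a) * (c - a * z t) + Real.exp (t * a) * (0 - a * Y t)) t := fun t =>
    (((hasDerivAt_id t).mul_const a).exp).mul
      ((hasDerivAt_const t c).sub ((hzd t).const_mul a))
  have hconst := constant_of_has_deriv_right_zero (a := 0) (b := t)
    (f := fun t => Real.exp (t * a) * (c - a * z t))
    (fun x _ => (hwd x).continuousAt.continuousWithinAt) (fun x hx => by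
      have := (hwd x).hasDerivWithinAt (s := Set.Ici x)
      rw [hyz x hx.1] at this
      convert! this using 1
      ring) t ⟨ht, le_rfl⟩
  have hz0 : z 0 = 0 := by simp [hz]
  have hYt : Y t = y t := by simp [hY, max_eq_left ht]
  simp only [hz0, mul_zero, sub_zero, zero_mul, Real.exp_zero, one_mul] at hconst
  rw [← hyz t ht, hYt] at hconst
  rw [Real.exp_neg, ← div_eq_mul_inv, eq_div_iff (Real.exp_pos _).ne', ← hconst, mul_comm]

namespace IsWeakSolution

variable {n : ℕ} {s : ℝ} {u₀ : EuclideanSpace ℝ (Fin n) → ℝ}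
  {u : ℝ → EuclideanSpace ℝ (Fin n) → ℝ}

lemma continuousOn_integral_mul (hu : IsWeakSolution s u₀ u) {g : EuclideanSpace ℝ (Fin n) → ℝ}
    (hg : Continuous g) {B : ℝ} (hB : ∀ x, |g x| ≤ B) :
    ContinuousOn (fun τ => ∫ x, u τ x * g x) (Set.Ici 0) := by
  intro t ht
  have hmul : ∀ τ, 0 ≤ τ → Integrable fun x => u τ x * g x := fun τ hτ =>
    (hu.integrable τ hτ).mul_bdd (c := B) hg.aestronglyMeasurable (ae_of_all _ hB)
  rw [ContinuousWithinAt, tendsto_iff_norm_sub_tendsto_zero]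
  have h0 := (hu.continuous_L1 t ht).mul_const B
  rw [zero_mul] at h0
  refine squeeze_zero' (Eventually.of_forall fun _ => norm_nonneg _) ?_ h0
  filter_upwards [self_mem_nhdsWithin] with τ hτ
  rw [← integral_sub (hmul τ hτ) (hmul t ht), ← integral_mul_const]
  refine norm_integral_le_of_norm_le
    (((hu.integrable τ hτ).sub (hu.integrable t ht)).abs.mul_const B) (ae_of_all _ fun x => ?_)
  rw [← sub_mul, norm_mul]
  exact mul_le_mul_of_nonneg_left (hB x) (norm_nonneg _)

lemma continuousOn_integral_abs (hu : IsWeakSolution s u₀ u) :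
    ContinuousOn (fun τ => ∫ x, |u τ x|) (Set.Ici 0) := by
  intro t ht
  rw [ContinuousWithinAt, tendsto_iff_norm_sub_tendsto_zero]
  refine squeeze_zero' (Eventually.of_forall fun _ => norm_nonneg _) ?_ (hu.continuous_L1 t ht)
  filter_upwards [self_mem_nhdsWithin] with τ hτ
  rw [← integral_sub (hu.integrable τ hτ).abs (hu.integrable t ht).abs]
  exact norm_integral_le_of_norm_le ((hu.integrable τ hτ).sub (hu.integrable t ht)).abs
    (ae_of_all _ fun x => abs_abs_sub_abs_le _ _)

/-- A weak solution may be tested with plane waves. -/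
lemma integral_mul_planeWave (hu : IsWeakSolution s u₀ u) (hs0 : 0 < s) (hs1 : s < 1)
    (hu₀ : Integrable u₀) (w : ℂ) (ξ : EuclideanSpace ℝ (Fin n)) {t : ℝ} (ht : 0 ≤ t) :
    ∫ x, u t x * planeWave w ξ x = (∫ x, u₀ x * planeWave w ξ x)
      - ∫ τ in (0 : ℝ)..t, fracSymbol s ξ * ∫ x, u τ x * planeWave w ξ x := by
  set ε : ℕ → ℝ := fun k => 1 / ((k : ℝ) + 1) with hεd
  have hε0 : ∀ k, 0 < ε k := fun k => by positivity
  have hε1 : ∀ k, ε k ≤ 1 := fun k => by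
    rw [hεd]; exact div_le_one_of_le₀ (by linarith [Nat.cast_nonneg (α := ℝ) k]) (by positivity)
  have hε : Tendsto ε atTop (𝓝 0) := tendsto_one_div_add_atTop_nhds_zero_nat
  obtain ⟨B, hB⟩ := exists_abs_fracLaplacian_testWave_le hs0 hs1 w ξ
  have hcont : ∀ k, Continuous (testWave w (ε k) ξ) := fun k => (contDiff_testWave w (ε k) ξ).continuous
  have l1 := tendsto_integral_mul_of_bounded (hu.integrable t ht) hcont
    (fun k x => abs_testWave_le w (ε k) ξ x) (tendsto_testWave w hε ξ)
  have l2 := tendsto_integral_mul_of_bounded hu₀ hcont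
    (fun k x => abs_testWave_le w (ε k) ξ x) (tendsto_testWave w hε ξ)
  have l3 : Tendsto (fun k => ∫ τ in (0 : ℝ)..t, ∫ x, u τ x * fracLaplacian s (testWave w (ε k) ξ) x)
      atTop (𝓝 (∫ τ in (0 : ℝ)..t, fracSymbol s ξ * ∫ x, u τ x * planeWave w ξ x)) := by
    have hsub : Set.uIcc 0 t ⊆ Set.Ici 0 := by
      rw [Set.uIcc_of_le ht]; exact fun x hx => hx.1
    have hsub' : Set.uIoc 0 t ⊆ Set.Ici 0 := by
      rw [Set.uIoc_of_le ht]; exact fun x hx => hx.1.le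
    -- The bound B is uniform in the cutoff scale and the L¹ norm of u(τ) is continuous in τ, so the
    -- product is an integrable majorant on [0,t].
    refine intervalIntegral.tendsto_integral_filter_of_dominated_convergence
      (fun τ => (∫ x, |u τ x|) * B) (Eventually.of_forall fun k => ?_)
      (Eventually.of_forall fun k => ae_of_all _ fun τ hτ => ?_) ?_ (ae_of_all _ fun τ hτ => ?_)
    · exact ((hu.continuousOn_integral_mul
        (continuous_fracLaplacian_testWave hs0 hs1 (hε0 k).ne' w ξ)
        (hB (ε k) (hε0 k) (hε1 k))).mono hsub').aestronglyMeasurable measurableSet_uIoc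
    · rw [← integral_mul_const]
      refine norm_integral_le_of_norm_le ((hu.integrable τ (hsub' hτ)).abs.mul_const B)
        (ae_of_all _ fun x => ?_)
      rw [norm_mul]
      exact mul_le_mul_of_nonneg_left (hB (ε k) (hε0 k) (hε1 k) x) (norm_nonneg _)
    · exact ((hu.continuousOn_integral_abs.mono hsub).mul continuousOn_const).intervalIntegrable
    · have h := tendsto_integral_mul_of_bounded (hu.integrable τ (hsub' hτ))
        (fun k => continuous_fracLaplacian_testWave hs0 hs1 (hε0 k).ne' w ξ)
        (fun k => hB (ε k) (hε0 k) (hε1 k)) (tendsto_fracLaplacian_testWave hs0 hs1 w hε0 hε1 hε ξ)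
      rw [← integral_const_mul]
      simp_rw [mul_left_comm (fracSymbol s ξ)]
      exact h
  refine tendsto_nhds_unique l1 ((l2.sub l3).congr fun k => ?_)
  exact (hu.weak _ (contDiff_testWave w (ε k) ξ)
    (hasCompactSupport_testWave w (hε0 k).ne' ξ) t ht).symm

lemma integral_mul_planeWave_eq (hu : IsWeakSolution s u₀ u) (hs0 : 0 < s) (hs1 : s < 1)
    (hu₀ : Integrable u₀) (w : ℂ) (ξ : EuclideanSpace ℝ (Fin n)) {t : ℝ} (ht : 0 ≤ t) :
    ∫ x, u t x * planeWave w ξ x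
      = (∫ x, u₀ x * planeWave w ξ x) * Real.exp (-(t * fracSymbol s ξ)) :=
  eq_mul_exp_of_integral_eq (y := fun τ => ∫ x, u τ x * planeWave w ξ x)
    (hu.continuousOn_integral_mul (continuous_planeWave w ξ) (abs_planeWave_le w ξ))
    (fun _ ht => hu.integral_mul_planeWave hs0 hs1 hu₀ w ξ ht) ht

end IsWeakSolution

lemma integral_mul_planeWave_eq_re {n : ℕ} {v : EuclideanSpace ℝ (Fin n) → ℝ} (hv : Integrable v)
    (w : ℂ) (ξ : EuclideanSpace ℝ (Fin n)) :
    ∫ x, v x * planeWave w (-ξ) x = (w * 𝓕 (fun x => ((v x : ℝ) : ℂ)) ξ).re := by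
  have hv' : Integrable fun x => ((v x : ℝ) : ℂ) := hv.ofReal
  have hi := ((Real.fourierIntegral_convergent_iff ξ).2 hv').const_mul w
  rw [Real.fourier_eq, ← integral_const_mul]
  refine Eq.trans ?_ (integral_re hi)
  congr 1 with x
  rw [planeWave, inner_neg_right, Circle.smul_def, smul_eq_mul, ← Complex.re_ofReal_mul]
  simp only [RCLike.re_to_complex]
  congr 1
  ring

namespace IsWeakSolution

variable {n : ℕ} {s : ℝ} {u₀ : EuclideanSpace ℝ (Fin n) → ℝ}
  {u : ℝ → EuclideanSpace ℝ (Fin n) → ℝ}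

/-- Real test functions yield only real parts of w times the Fourier coefficient; w = 1 and w = -i
recover its real and imaginary parts. -/
lemma fourier_eq (hu : IsWeakSolution s u₀ u) (hs0 : 0 < s) (hs1 : s < 1)
    (hu₀ : Integrable u₀) {t : ℝ} (ht : 0 ≤ t) (ξ : EuclideanSpace ℝ (Fin n)) :
    𝓕 (fun x => ((u t x : ℝ) : ℂ)) ξ
      = ((heatSymbol s t ξ : ℝ) : ℂ) * 𝓕 (fun x => ((u₀ x : ℝ) : ℂ)) ξ := by
  have key : ∀ w : ℂ, (w * 𝓕 (fun x => ((u t x : ℝ) : ℂ)) ξ).re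
      = (w * 𝓕 (fun x => ((u₀ x : ℝ) : ℂ)) ξ).re * heatSymbol s t ξ := fun w => by
    rw [← integral_mul_planeWave_eq_re (hu.integrable t ht), ← integral_mul_planeWave_eq_re hu₀,
      hu.integral_mul_planeWave_eq hs0 hs1 hu₀ w (-ξ) ht, heatSymbol, fracSymbol, norm_neg]
  apply Complex.ext
  · have := key 1
    rw [one_mul, one_mul] at this
    rw [this, Complex.re_ofReal_mul, mul_comm]
  · have := key (-Complex.I)
    simp only [neg_mul, Complex.neg_re, Complex.I_mul_re, neg_neg] at this
    rw [this, Complex.im_ofReal_mul, mul_comm]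

/-- A weak solution is given by the representation formula. -/
lemma ae_eq_heatSolution (hn : 1 ≤ n) (hu : IsWeakSolution s u₀ u) (hs0 : 0 < s) (hs1 : s < 1)
    (hu₀ : Integrable u₀) {t : ℝ} (ht : 0 < t) : ∀ᵐ x, u t x = heatSolution s u₀ t x := by
  have hF : 𝓕 (fun x => ((u t x : ℝ) : ℂ))
      = fun ξ => ((heatSymbol s t ξ : ℝ) : ℂ) * 𝓕 (fun x => ((u₀ x : ℝ) : ℂ)) ξ :=
    funext fun ξ => hu.fourier_eq hs0 hs1 hu₀ ht.le ξ
  have h := ae_eq_fourierInv_fourier (hu.integrable t ht.le).ofReal (U := fun x => ((u t x : ℝ) : ℂ))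
    (by rw [hF]; exact integrable_heatSymbol_mul_fourier hn hs0 ht hu₀.ofReal)
  filter_upwards [h] with x hx
  rw [hF, ← heatSolution_eq_fourierInv hn hs0 hs1 ht hu₀] at hx
  exact_mod_cast hx

end IsWeakSolution

/-! ### Assembly of the fractional and Gaussian cases -/

theorem theorem3 (n : ℕ) (hn : 1 ≤ n) :
    -- fractional case: `C` depends only on `n, s`, and "large `t`" only on `n, s, R`
    (∀ s : ℝ, 0 < s → s < 1 → ∃ C : ℝ, 0 < C ∧ ∀ R : ℝ, 0 < R → ∃ T : ℝ, 0 < T ∧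
      ∀ u₀ : EuclideanSpace ℝ (Fin n) → ℝ, Integrable u₀ →
        (∀ᵐ y, y ∉ Metric.closedBall (0 : EuclideanSpace ℝ (Fin n)) R → u₀ y = 0) →
        ∀ t : ℝ, T ≤ t →
          (∀ x : EuclideanSpace ℝ (Fin n), 0 < heatKernel s t x) ∧
          (∀ x, relError s (∫ y, u₀ y) t (heatSolution s u₀ t) x
              ≤ C * (∫ y, |u₀ y|) * R * t ^ (-(1 / (2 * s)))) ∧
          (0 ≤ᵐ[volume] u₀ →
            ∀ x, relError s (∫ y, u₀ y) t (heatSolution s u₀ t) x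
              ≤ C * (∫ y, u₀ y) * R * t ^ (-(1 / (2 * s)))) ∧
          (∀ u : ℝ → EuclideanSpace ℝ (Fin n) → ℝ, IsWeakSolution s u₀ u →
            ∀ᵐ x, relError s (∫ y, u₀ y) t (u t) x
              ≤ C * (∫ y, |u₀ y|) * R * t ^ (-(1 / (2 * s))))) ∧
    -- Gaussian case, datum a point mass at `h ≠ 0`: unbounded relative error at every time
    (∀ h : EuclideanSpace ℝ (Fin n), h ≠ 0 → ∀ t : ℝ, 0 < t → ∀ K : ℝ,
      ∃ x, K < relError 1 1 t (fun z => heatKernel 1 t (z - h)) x) ∧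
    -- Gaussian case, nonnegative compactly supported integrable data of positive mass
    (∀ R : ℝ, 0 < R → ∀ u₀ : EuclideanSpace ℝ (Fin n) → ℝ, Integrable u₀ →
      (∀ᵐ y, y ∉ Metric.closedBall (0 : EuclideanSpace ℝ (Fin n)) R → u₀ y = 0) →
      0 ≤ᵐ[volume] u₀ → 0 < ∫ y, u₀ y → ∀ t : ℝ, 0 < t → ∀ K : ℝ,
        ∃ x, K < relError 1 (∫ y, u₀ y) t (heatSolution 1 u₀ t) x) := by
  refine ⟨fun s hs0 hs1 => ?_, fun h hh t ht K => exists_lt_relError_translate hh ht K,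
    fun R _ u₀ hu _ hu0 hM t ht K => exists_lt_relError_heatSolution_one hn hu hu0 hM ht K⟩
  obtain ⟨C, hC, hle⟩ := relError_heatSolution_le hn hs0 hs1
  -- T = R^{2s} is exactly the time from which R ≤ t^{1/2s}, so that all of the support lies within
  -- the scale of the Lipschitz bound.
  refine ⟨C, hC, fun R hR => ⟨R ^ (2 * s), by positivity, fun u₀ hu hsupp t ht => ?_⟩⟩
  have ht0 : 0 < t := lt_of_lt_of_le (by positivity) ht
  have hRt : R ≤ t ^ (1 / (2 * s)) := by
    have h1 := Real.rpow_le_rpow (by positivity) ht (show 0 ≤ 1 / (2 * s) by positivity)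
    rwa [← Real.rpow_mul hR.le, mul_one_div_cancel (by positivity), Real.rpow_one] at h1
  obtain ⟨hpos, hbound⟩ := hle R t hR ht0 hRt u₀ hu hsupp
  refine ⟨hpos, hbound, fun hu0 x => ?_, fun u hw => ?_⟩
  · have habs : ∫ y, |u₀ y| = ∫ y, u₀ y :=
      integral_congr_ae (hu0.mono fun y hy => abs_of_nonneg hy)
    exact habs ▸ hbound x
  · filter_upwards [hw.ae_eq_heatSolution hn hs0 hs1 hu ht0] with x hx
    have := hbound x
    rwa [relError, ← hx] at this
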